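/- Let $G$ be the solvable Lie group with underlying manifold $\mathbb{R}^6$, coordinates $(t,x,y_1,y_2,z_1,z_2)$ and group law $$(t,x,y_1,y_2,z_1,z_2)*(t',x',y_1',y_2',z_1',z_2')=\left(t+t',\,x+x',\,e^{t}y_1'+xe^{t}z_1'+y_1,\,e^{-t}y_2'+xe^{-t}z_2'+y_2,\,e^{t}z_1'+z_1,\,e^{-t}z_2'+z_2\right).$$ Let $B\in SL(2,\mathbb{Z})$, $a_0\in\mathbb{R}\setminus\{0\}$ and $P\in GL(2,\mathbb{R})$ satisfy $PBP^{-1}=\operatorname{diag}(e^{a_0},e^{-a_0})$, let $\Gamma=\{(t,x,y,z): t\in a_0\mathbb{Z},\ x\in\mathbb{Z},\ y,z\in P\mathbb{Z}^2\}$ (with $y=(y_1,y_2)$, $z=(z_1,z_2)$) be the corresponding lattice in $G$, and let $X=\Gamma\backslash G$ be the associated compact solvmanifold. Consider the left-invariant coframe $$e^1=dt,\quad e^2=dx,\quad e^3=e^{-t}(dy_1-x\,dz_1),\quad e^4=e^{t}(dy_2-x\,dz_2),\quad e^5=e^{-t}dz_1,\quad e^6=e^{t}dz_2,$$ which descends to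 $X$. Let $J$ be the almost-complex structure on $X$ for which $\Phi^1=e^1+ie^2$, $\Phi^2=e^3+ie^4$, $\Phi^3=e^5+ie^6$ is a global coframe of $(1,0)$-forms, and endow $X$ with the $J$-Hermitian metric $g=\sum_{j=1}^6 e^j\otimes e^j$, with fundamental form $\omega=e^1\wedge e^2+e^3\wedge e^4+e^5\wedge e^6$. Let $\overline\partial:A^{p,q}(X)\to A^{p,q+1}(X)$ be the $(p,q+1)$-component of the exterior derivative on smooth complex-valued $(p,q)$-forms, let $\overline\partial^*$ be its formal adjoint with respect to the $L^2$ product defined by $g$, let $\Delta_{\overline\partial}=\overline\partial\,\overline\partial^*+\overline\partial^*\overline\partial$, and let $h^{p,q}_{\overline\partial}=\dim_{\mathbb{C}}\ker\left(\Delta_{\overline\partial}|_{A^{p,q}(X)}\right)$. Then $$h^{1,0}_{\overline\partial}=1,\qquad h^{2,0}_{\overline\partial}=1,\qquad h^{3,0}_{\overline\partial}=1.$$ -/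

import Mathlib

open scoped ContDiff ComplexConjugate

noncomputable section

namespace Solvmanifold

/-! ### The solvable Lie group `G`, in the global coordinates `(t, x, y₁, y₂, z₁, z₂)` -/

/-- The underlying manifold `ℝ⁶` of `G`; the coordinates `0, …, 5` are `t, x, y₁, y₂, z₁, z₂`. -/
abbrev E : Type := Fin 6 → ℝ

/-- The point of `G` with given coordinates, as a matrix. -/
def toMatrix (g : E) : Matrix (Fin 6) (Fin 6) ℝ :=
  !![Real.exp (g 0), 0, g 1 * Real.exp (g 0), 0, 0, g 2;
     0, Real.exp (-g 0), 0, g 1 * Real.exp (-g 0), 0, g 3;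
     0, 0, Real.exp (g 0), 0, 0, g 4;
     0, 0, 0, Real.exp (-g 0), 0, g 5;
     0, 0, 0, 0, 1, g 0;
     0, 0, 0, 0, 0, 1]

/-- Left translation `h ↦ g * h` of the group `G`. -/
def leftMul (g h : E) : E :=
  ![g 0 + h 0,
    g 1 + h 1,
    h 2 * Real.exp (g 0) + g 1 * h 4 * Real.exp (g 0) + g 2,
    h 3 * Real.exp (-g 0) + g 1 * h 5 * Real.exp (-g 0) + g 3,
    h 4 * Real.exp (g 0) + g 4,
    h 5 * Real.exp (-g 0) + g 5]

/-- The group law is matrix multiplication. -/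
theorem toMatrix_leftMul (g h : E) : toMatrix (leftMul g h) = toMatrix g * toMatrix h := by
  ext i j
  fin_cases i <;> fin_cases j <;>
    simp [toMatrix, leftMul, Matrix.mul_apply, Fin.sum_univ_succ, Real.exp_add] <;> ring

/-- The left-invariant frame `e₁, …, e₆`. -/
def frame (p : E) : Fin 6 → E :=
  ![![1, 0, 0, 0, 0, 0],
    ![0, 1, 0, 0, 0, 0],
    ![0, 0, Real.exp (p 0), 0, 0, 0],
    ![0, 0, 0, Real.exp (-p 0), 0, 0],
    ![0, 0, p 1 * Real.exp (p 0), 0, Real.exp (p 0), 0],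
    ![0, 0, 0, p 1 * Real.exp (-p 0), 0, Real.exp (-p 0)]]

/-- The coordinate differentials `dt, dx, dy₁, dy₂, dz₁, dz₂`. -/
def dcoord (i : Fin 6) : E →L[ℝ] ℝ := ContinuousLinearMap.proj i

/-- The left-invariant coframe `e¹, …, e⁶`. -/
def coframe (p : E) : Fin 6 → (E →L[ℝ] ℝ) :=
  ![dcoord 0,
    dcoord 1,
    Real.exp (-p 0) • dcoord 2 - (p 1 * Real.exp (-p 0)) • dcoord 4,
    Real.exp (p 0) • dcoord 3 - (p 1 * Real.exp (p 0)) • dcoord 5,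
    Real.exp (-p 0) • dcoord 4,
    Real.exp (p 0) • dcoord 5]

theorem coframe_frame (p : E) (i j : Fin 6) :
    coframe p i (frame p j) = if i = j then 1 else 0 := by
  fin_cases i <;> fin_cases j <;>
    simp [coframe, frame, dcoord, Real.exp_neg] <;> field_simp <;> simp

/-! ### The almost-complex structure -/

/-- The coframe `Φ¹ = e¹ + i e²`, `Φ² = e³ + i e⁴`, `Φ³ = e⁵ + i e⁶`. -/
def Phi (p : E) : Fin 3 → (E →L[ℝ] ℂ) :=
  ![Complex.ofRealCLM ∘L coframe p 0 + Complex.I • (Complex.ofRealCLM ∘L coframe p 1),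
    Complex.ofRealCLM ∘L coframe p 2 + Complex.I • (Complex.ofRealCLM ∘L coframe p 3),
    Complex.ofRealCLM ∘L coframe p 4 + Complex.I • (Complex.ofRealCLM ∘L coframe p 5)]

/-- The almost-complex structure `J` on `T_p G`: `J e₁ = e₂`, `J e₃ = e₄`, `J e₅ = e₆`,
`J² = -1`. -/
def J (p : E) : E →L[ℝ] E :=
  (coframe p 0).smulRight (frame p 1) - (coframe p 1).smulRight (frame p 0)
    + (coframe p 2).smulRight (frame p 3) - (coframe p 3).smulRight (frame p 2)
    + (coframe p 4).smulRight (frame p 5) - (coframe p 5).smulRight (frame p 4)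

theorem J_J (p : E) (v : E) : J p (J p v) = -v := by
  funext i
  fin_cases i <;>
    simp [J, coframe, frame, dcoord, Real.exp_neg] <;> field_simp <;> ring

/-- `Φ¹, Φ², Φ³` are forms of type `(1,0)` for `J`. -/
theorem Phi_J (p : E) (j : Fin 3) (v : E) : Phi p j (J p v) = Complex.I * Phi p j v := by
  fin_cases j <;>
    simp [Phi, J, coframe_frame, mul_add, ← mul_assoc, add_comm]

/-! ### The lattice -/

/-- The linear map `(s₀, …, s₅) ↦ (a₀ s₀, s₁, P (s₂, s₃), P (s₄, s₅))`. -/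
def latticeMap (a₀ : ℝ) (P : Matrix (Fin 2) (Fin 2) ℝ) (s : E) : E :=
  ![a₀ * s 0, s 1,
    P 0 0 * s 2 + P 0 1 * s 3, P 1 0 * s 2 + P 1 1 * s 3,
    P 0 0 * s 4 + P 0 1 * s 5, P 1 0 * s 4 + P 1 1 * s 5]

/-- The lattice `Γ = (a₀ℤ × ℤ) ⋉ L` of `G`, where `L = {(P m, P n) : m, n ∈ ℤ²}`. -/
def lattice (a₀ : ℝ) (P : Matrix (Fin 2) (Fin 2) ℝ) : Set E :=
  {g | ∃ m : Fin 6 → ℤ, g = latticeMap a₀ P (fun i => (m i : ℝ))}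

/-- A fundamental domain for the action of `Γ` on `G` by left translations. -/
def fundDomain (a₀ : ℝ) (P : Matrix (Fin 2) (Fin 2) ℝ) : Set E :=
  latticeMap a₀ P '' {s | ∀ i, 0 ≤ s i ∧ s i < 1}

/-! ### Complex-valued forms and their types -/

/-- Complex-valued `k`-forms on `G` (with no regularity). -/
abbrev Form (k : ℕ) : Type := E → E [⋀^Fin k]→L[ℝ] ℂ

/-- For `S ⊆ Fin k`, the map
`(v₁, …, v_k) ↦ α(w₁, …, w_k)`, where `w_j = (v_j - i A v_j) / 2` for `j ∈ S`,
`w_j = (v_j + i A v_j) / 2` for `j ∉ S`, and `α` is extended complex-multilinearly. It is written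
out by expanding the product: `T` is the set of the slots in which `± i A v_j` is taken. -/
def mixedPart {k : ℕ} (A : E →L[ℝ] E) (S : Finset (Fin k)) (α : E [⋀^Fin k]→L[ℝ] ℂ) :
    ContinuousMultilinearMap ℝ (fun _ : Fin k => E) ℂ :=
  ((1 / 2 : ℂ) ^ k) • ∑ T : Finset (Fin k),
    (∏ j ∈ T, if j ∈ S then -Complex.I else Complex.I) •
      α.toContinuousMultilinearMap.compContinuousLinearMap
        (fun j => if j ∈ T then A else ContinuousLinearMap.id ℝ E)

theorem mixedPart_apply {k : ℕ} (A : E →L[ℝ] E) (S : Finset (Fin k)) (α : E [⋀^Fin k]→L[ℝ] ℂ)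
    (v : Fin k → E) :
    mixedPart A S α v = (1 / 2 : ℂ) ^ k * ∑ T : Finset (Fin k),
      (∏ j ∈ T, if j ∈ S then -Complex.I else Complex.I) *
        α (fun j => if j ∈ T then A (v j) else v j) := by
  simp only [mixedPart, smul_apply, sum_apply,
    smul_eq_mul, ContinuousMultilinearMap.compContinuousLinearMap_apply]
  congr 1
  refine Finset.sum_congr rfl fun T _ => ?_
  congr 1
  change α _ = α _
  congr 1
  funext j
  split_ifs <;> rfl

theorem sum_mixedPart_eq_zero {k : ℕ} (p : ℕ) (A : E →L[ℝ] E) (α : E [⋀^Fin k]→L[ℝ] ℂ)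
    (v : Fin k → E) (i j : Fin k) (hv : v i = v j) (hij : i ≠ j) :
    ∑ S ∈ Finset.powersetCard p (Finset.univ : Finset (Fin k)), mixedPart A S α v = 0 := by
  set σ : Equiv.Perm (Fin k) := Equiv.swap i j with hσ
  have hvσ : ∀ l, v (σ l) = v l := by
    intro l
    rcases eq_or_ne l i with rfl | h1
    · simp [hσ, hv]
    rcases eq_or_ne l j with rfl | h2
    · simp [hσ, hv]
    · simp [hσ, Equiv.swap_apply_of_ne_of_ne h1 h2]
  have key : ∀ S : Finset (Fin k),
      mixedPart A (S.map σ.toEmbedding) α v = - mixedPart A S α v := by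
    intro S
    rw [mixedPart_apply, mixedPart_apply, ← mul_neg, ← Finset.sum_neg_distrib]
    congr 1
    refine (Fintype.sum_equiv (Equiv.finsetCongr σ) _ _ fun T => ?_).symm
    have h1 : ∏ l ∈ (Equiv.finsetCongr σ) T,
        (if l ∈ S.map σ.toEmbedding then -Complex.I else Complex.I) =
        ∏ l ∈ T, if l ∈ S then -Complex.I else Complex.I := by
      rw [Equiv.finsetCongr_apply, Finset.prod_map]
      simp
    have h2 : (fun l => if l ∈ (Equiv.finsetCongr σ) T then A (v l) else v l) ∘ σ =
        fun l => if l ∈ T then A (v l) else v l := by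
      funext l
      simp [hvσ]
    rw [h1, ← h2, ← mul_neg]
    congr 1
    have := α.toAlternatingMap.map_swap
      (fun l => if l ∈ (Equiv.finsetCongr σ) T then A (v l) else v l) hij
    change α _ = - α _ at this
    rw [← hσ] at this
    rw [this, neg_neg]
  have hsum : ∑ S ∈ Finset.powersetCard p (Finset.univ : Finset (Fin k)), mixedPart A S α v =
      ∑ S ∈ Finset.powersetCard p (Finset.univ : Finset (Fin k)), - mixedPart A S α v := by
    refine (Finset.sum_equiv (Equiv.finsetCongr σ) ?_ ?_).symm
    · intro S
      simp [Finset.mem_powersetCard]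
    · intro S _
      rw [Equiv.finsetCongr_apply, key]
  rw [Finset.sum_neg_distrib] at hsum
  exact self_eq_neg.mp hsum

/-- The component of type `(p, k - p)` of a complex-valued alternating `k`-form `α` on a real
vector space with complex structure `A`: exactly `p` of the arguments are replaced by their
`(1,0)`-parts, and the others by their `(0,1)`-parts. -/
def typeProj {k : ℕ} (A : E →L[ℝ] E) (p : ℕ) (α : E [⋀^Fin k]→L[ℝ] ℂ) : E [⋀^Fin k]→L[ℝ] ℂ where
  toContinuousMultilinearMap :=
    ∑ S ∈ Finset.powersetCard p (Finset.univ : Finset (Fin k)), mixedPart A S α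
  map_eq_zero_of_eq' v i j hv hij := by
    simpa using sum_mixedPart_eq_zero p A α v i j hv hij

theorem typeProj_apply {k : ℕ} (A : E →L[ℝ] E) (p : ℕ) (α : E [⋀^Fin k]→L[ℝ] ℂ)
    (v : Fin k → E) :
    typeProj A p α v =
      ∑ S ∈ Finset.powersetCard p (Finset.univ : Finset (Fin k)), mixedPart A S α v := by
  change (∑ S ∈ Finset.powersetCard p (Finset.univ : Finset (Fin k)), mixedPart A S α) v = _
  simp

theorem typeProj_add {k : ℕ} (A : E →L[ℝ] E) (p : ℕ) (α β : E [⋀^Fin k]→L[ℝ] ℂ) :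
    typeProj A p (α + β) = typeProj A p α + typeProj A p β := by
  ext v
  simp only [typeProj_apply, mixedPart_apply, ContinuousAlternatingMap.add_apply, mul_add,
    Finset.sum_add_distrib]

theorem typeProj_smul {k : ℕ} (A : E →L[ℝ] E) (p : ℕ) (c : ℂ) (α : E [⋀^Fin k]→L[ℝ] ℂ) :
    typeProj A p (c • α) = c • typeProj A p α := by
  ext v
  simp only [typeProj_apply, mixedPart_apply, ContinuousAlternatingMap.smul_apply, smul_eq_mul,
    Finset.mul_sum]
  refine Finset.sum_congr rfl fun S _ => Finset.sum_congr rfl fun T _ => ?_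
  ring

/-- The space `A^{p,q}(X)` of smooth complex-valued forms of type `(p,q)` on `X = Γ \ G`: the
smooth `Γ`-invariant forms on `G` of type `(p,q)`. -/
def A (a₀ : ℝ) (P : Matrix (Fin 2) (Fin 2) ℝ) (p q : ℕ) : Submodule ℂ (Form (p + q)) where
  carrier := {ψ | ContDiff ℝ ∞ ψ ∧
    (∀ g ∈ lattice a₀ P, ∀ x,
      (ψ (leftMul g x)).compContinuousLinearMap (fderiv ℝ (leftMul g) x) = ψ x) ∧
    ∀ x, typeProj (J x) p (ψ x) = ψ x}
  zero_mem' := by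
    refine ⟨contDiff_const, fun g _ x => ?_, fun x => ?_⟩
    · ext v
      simp
    · ext v
      simp [typeProj_apply, mixedPart_apply]
  add_mem' := by
    rintro ψ φ ⟨h1, h2, h3⟩ ⟨h1', h2', h3'⟩
    refine ⟨h1.add h1', fun g hg x => ?_, fun x => ?_⟩
    · rw [Pi.add_apply, Pi.add_apply, ← h2 g hg x, ← h2' g hg x]
      rfl
    · rw [Pi.add_apply, typeProj_add, h3, h3']
  smul_mem' := by
    rintro c ψ ⟨h1, h2, h3⟩
    refine ⟨contDiff_const.smul h1, fun g hg x => ?_, fun x => ?_⟩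
    · rw [Pi.smul_apply, Pi.smul_apply, ← h2 g hg x]
      rfl
    · rw [Pi.smul_apply, typeProj_smul, h3]

/-- The operator `∂̄` on forms of type `(p,q)`: the component of type `(p,q+1)` of `d`. -/
def dbar (p q : ℕ) (ψ : Form (p + q)) : Form (p + (q + 1)) :=
  fun x => typeProj (J x) p (extDeriv ψ x)

/-! ### The metric, the formal adjoint of `∂̄` and the Laplacian -/

/-- The Hermitian product at `x` of complex-valued `k`-forms, induced by the metric
`∑ eⁱ ⊗ eⁱ` with fundamental form `e¹² + e³⁴ + e⁵⁶`. -/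
def formInner {k : ℕ} (x : E) (α β : E [⋀^Fin k]→L[ℝ] ℂ) : ℂ :=
  (1 / (k.factorial : ℂ)) * ∑ I : Fin k → Fin 6,
    α (fun j => frame x (I j)) * conj (β (fun j => frame x (I j)))

/-- The `L²` Hermitian product of `Γ`-invariant forms over `X`. The Riemannian volume form
`e¹²³⁴⁵⁶` is `dt dx dy₁ dy₂ dz₁ dz₂`. -/
def L2 (a₀ : ℝ) (P : Matrix (Fin 2) (Fin 2) ℝ) {k : ℕ} (α β : Form k) : ℂ :=
  ∫ x in fundDomain a₀ P, formInner x (α x) (β x)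

/-- `β = ∂̄* η` where `∂̄*` is the formal adjoint of `∂̄ : A^{p,q}(X) → A^{p,q+1}(X)`. -/
def IsDbarStar (a₀ : ℝ) (P : Matrix (Fin 2) (Fin 2) ℝ) (p q : ℕ)
    (η : Form (p + (q + 1))) (β : Form (p + q)) : Prop :=
  β ∈ A a₀ P p q ∧ ∀ φ ∈ A a₀ P p q, L2 a₀ P (dbar p q φ) η = L2 a₀ P φ β

/-- `ρ = (∂̄ ∂̄* + ∂̄* ∂̄) ψ` for `ψ ∈ A^{p,q}(X)`; on `A^{p,0}(X)` the operator `∂̄*` vanishes,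
as there are no forms of type `(p,-1)`. -/
def IsLaplacian (a₀ : ℝ) (P : Matrix (Fin 2) (Fin 2) ℝ) (p : ℕ) :
    (q : ℕ) → Form (p + q) → Form (p + q) → Prop
  | 0, ψ, ρ => IsDbarStar a₀ P p 0 (dbar p 0 ψ) ρ
  | q + 1, ψ, ρ => ∃ (α : Form (p + q)) (β : Form (p + (q + 1))),
      IsDbarStar a₀ P p q ψ α ∧ IsDbarStar a₀ P p (q + 1) (dbar p (q + 1) ψ) β ∧
        ρ = dbar p q α + β

theorem dbar_add {p q : ℕ} {ψ φ : Form (p + q)} (hψ : ContDiff ℝ ∞ ψ) (hφ : ContDiff ℝ ∞ φ) :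
    dbar p q (ψ + φ) = dbar p q ψ + dbar p q φ := by
  funext x
  simp only [dbar, Pi.add_apply]
  rw [extDeriv_add (hψ.differentiable (by simp) x) (hφ.differentiable (by simp) x)]
  exact typeProj_add _ _ _ _

theorem dbar_smul {p q : ℕ} (c : ℂ) {ψ : Form (p + q)} (hψ : ContDiff ℝ ∞ ψ) :
    dbar p q (c • ψ) = c • dbar p q ψ := by
  funext x
  have h : extDeriv (c • ψ) x = c • extDeriv ψ x := by
    have hd : fderiv ℝ (c • ψ) x = c • fderiv ℝ ψ x :=
      fderiv_const_smul (hψ.differentiable (by simp) x) c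
    ext v
    simp only [extDeriv, hd, ContinuousAlternatingMap.smul_apply,
      ContinuousAlternatingMap.alternatizeUncurryFin_apply, Finset.smul_sum]
    refine Finset.sum_congr rfl fun i _ => ?_
    rw [smul_comm c]
    rfl
  simp only [dbar, Pi.smul_apply]
  rw [h]
  exact typeProj_smul _ _ _ _

theorem continuous_frame (i : Fin 6) : Continuous fun x => frame x i := by
  refine continuous_pi fun j => ?_
  fin_cases i <;> fin_cases j <;> simp [frame] <;> fun_prop

theorem continuous_J_apply {u : E → E} (hu : Continuous u) : Continuous fun x => J x (u x) := by
  have hc : ∀ i, Continuous fun x => coframe x i (u x) := by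
    intro i
    fin_cases i <;> simp [coframe, dcoord] <;> fun_prop
  have hf := continuous_frame
  simp only [J, add_apply, sub_apply,
    ContinuousLinearMap.smulRight_apply]
  exact (((((hc 0).smul (hf 1)).sub ((hc 1).smul (hf 0))).add ((hc 2).smul (hf 3))).sub
    ((hc 3).smul (hf 2))).add ((hc 4).smul (hf 5)) |>.sub ((hc 5).smul (hf 4))

/-- Weak continuity of a form: continuous coefficients in the frame. -/
def ContCoeff {k : ℕ} (α : Form k) : Prop :=
  ∀ I : Fin k → Fin 6, Continuous fun x => α x (fun j => frame x (I j))

theorem ContCoeff.of_continuous {k : ℕ} {α : Form k} (h : Continuous α) : ContCoeff α :=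
  fun I => h.eval (continuous_pi fun j => continuous_frame (I j))

theorem contCoeff_dbar {p q : ℕ} {ψ : Form (p + q)} (hψ : ContDiff ℝ ∞ ψ) :
    ContCoeff (dbar p q ψ) := by
  intro I
  have hd : Continuous (extDeriv ψ) := by
    have h1 : Continuous (fderiv ℝ ψ) := hψ.continuous_fderiv (by simp)
    exact (ContinuousAlternatingMap.alternatizeUncurryFinCLM ℝ E ℂ).continuous.comp h1
  simp only [dbar, typeProj_apply, mixedPart_apply]
  refine continuous_finsetSum _ fun S _ => continuous_const.mul <|
    continuous_finsetSum _ fun T _ => continuous_const.mul ?_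
  refine hd.eval (continuous_pi fun j => ?_)
  by_cases hj : j ∈ T
  · simpa [hj] using continuous_J_apply (continuous_frame (I j))
  · simpa [hj] using continuous_frame (I j)

theorem integrable_inner (a₀ : ℝ) (P : Matrix (Fin 2) (Fin 2) ℝ) {k : ℕ} {α β : Form k}
    (hα : ContCoeff α) (hβ : ContCoeff β) :
    MeasureTheory.IntegrableOn (fun x => formInner x (α x) (β x)) (fundDomain a₀ P) := by
  have hc : Continuous fun x => formInner x (α x) (β x) := by
    refine continuous_const.mul <| continuous_finsetSum _ fun I _ => (hα I).mul ?_
    exact Complex.continuous_conj.comp (hβ I)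
  have hm : Continuous (latticeMap a₀ P) := by
    refine continuous_pi fun j => ?_
    fin_cases j <;> simp [latticeMap] <;> fun_prop
  have hK : IsCompact (latticeMap a₀ P '' Set.Icc 0 1) := isCompact_Icc.image hm
  refine (hc.continuousOn.integrableOn_compact hK).mono_set ?_
  exact Set.image_mono fun s hs => ⟨fun i => (hs i).1, fun i => (hs i).2.le⟩

theorem L2_add_right (a₀ : ℝ) (P : Matrix (Fin 2) (Fin 2) ℝ) {k : ℕ} {α β γ : Form k}
    (hα : ContCoeff α) (hβ : ContCoeff β) (hγ : ContCoeff γ) :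
    L2 a₀ P α (β + γ) = L2 a₀ P α β + L2 a₀ P α γ := by
  rw [L2, L2, L2,
    ← MeasureTheory.integral_add (integrable_inner a₀ P hα hβ) (integrable_inner a₀ P hα hγ)]
  congr 1
  funext x
  simp [formInner, mul_add, Finset.sum_add_distrib]

theorem L2_smul_right (a₀ : ℝ) (P : Matrix (Fin 2) (Fin 2) ℝ) {k : ℕ} (c : ℂ) (α β : Form k) :
    L2 a₀ P α (c • β) = conj c * L2 a₀ P α β := by
  rw [L2, L2, ← MeasureTheory.integral_const_mul]
  congr 1
  funext x
  simp only [formInner, Pi.smul_apply, ContinuousAlternatingMap.smul_apply, smul_eq_mul, map_mul,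
    Finset.mul_sum]
  refine Finset.sum_congr rfl fun I _ => ?_
  ring

section

variable {a₀ : ℝ} {P : Matrix (Fin 2) (Fin 2) ℝ} {p q : ℕ}

theorem contCoeff_of_mem {ψ : Form (p + q)} (h : ψ ∈ A a₀ P p q) : ContCoeff ψ :=
  ContCoeff.of_continuous h.1.continuous

theorem IsDbarStar.add {η η' : Form (p + (q + 1))} {β β' : Form (p + q)}
    (hη : ContCoeff η) (hη' : ContCoeff η')
    (h : IsDbarStar a₀ P p q η β) (h' : IsDbarStar a₀ P p q η' β') :
    IsDbarStar a₀ P p q (η + η') (β + β') := by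
  refine ⟨add_mem h.1 h'.1, fun φ hφ => ?_⟩
  rw [L2_add_right a₀ P (contCoeff_dbar hφ.1) hη hη',
    L2_add_right a₀ P (contCoeff_of_mem hφ) (contCoeff_of_mem h.1) (contCoeff_of_mem h'.1),
    h.2 φ hφ, h'.2 φ hφ]

theorem IsDbarStar.smul (c : ℂ) {η : Form (p + (q + 1))} {β : Form (p + q)}
    (h : IsDbarStar a₀ P p q η β) : IsDbarStar a₀ P p q (c • η) (c • β) := by
  refine ⟨Submodule.smul_mem _ c h.1, fun φ hφ => ?_⟩
  rw [L2_smul_right, L2_smul_right, h.2 φ hφ]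

theorem IsLaplacian.add {ψ ψ' ρ ρ' : Form (p + q)}
    (hψ : ψ ∈ A a₀ P p q) (hψ' : ψ' ∈ A a₀ P p q)
    (h : IsLaplacian a₀ P p q ψ ρ) (h' : IsLaplacian a₀ P p q ψ' ρ') :
    IsLaplacian a₀ P p q (ψ + ψ') (ρ + ρ') := by
  cases q with
  | zero =>
    simp only [IsLaplacian] at h h' ⊢
    rw [dbar_add hψ.1 hψ'.1]
    exact h.add (contCoeff_dbar hψ.1) (contCoeff_dbar hψ'.1) h'
  | succ q =>
    obtain ⟨α, β, h1, h2, h3⟩ := h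
    obtain ⟨α', β', h1', h2', h3'⟩ := h'
    refine ⟨α + α', β + β', h1.add (contCoeff_of_mem hψ) (contCoeff_of_mem hψ') h1', ?_, ?_⟩
    · rw [dbar_add hψ.1 hψ'.1]
      exact h2.add (contCoeff_dbar hψ.1) (contCoeff_dbar hψ'.1) h2'
    · rw [dbar_add h1.1.1 h1'.1.1, h3, h3']
      abel

theorem IsLaplacian.smul (c : ℂ) {ψ ρ : Form (p + q)} (hψ : ψ ∈ A a₀ P p q)
    (h : IsLaplacian a₀ P p q ψ ρ) : IsLaplacian a₀ P p q (c • ψ) (c • ρ) := by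
  cases q with
  | zero =>
    simp only [IsLaplacian] at h ⊢
    rw [dbar_smul c hψ.1]
    exact h.smul c
  | succ q =>
    obtain ⟨α, β, h1, h2, h3⟩ := h
    refine ⟨c • α, c • β, h1.smul c, ?_, ?_⟩
    · rw [dbar_smul c hψ.1]
      exact h2.smul c
    · rw [dbar_smul c h1.1.1, h3, smul_add]

theorem IsDbarStar.zero : IsDbarStar a₀ P p q 0 0 :=
  ⟨zero_mem _, fun φ _ => by simp [L2, formInner]⟩

theorem dbar_zero : dbar p q 0 = 0 := by
  have h := dbar_add (p := p) (q := q) (ψ := 0) (φ := 0) contDiff_const contDiff_const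
  rw [add_zero] at h
  exact left_eq_add.mp h

theorem IsLaplacian.zero : IsLaplacian a₀ P p q 0 0 := by
  cases q with
  | zero =>
    simp only [IsLaplacian]
    rw [dbar_zero]
    exact IsDbarStar.zero
  | succ q =>
    refine ⟨0, 0, IsDbarStar.zero, ?_, ?_⟩
    · rw [dbar_zero]
      exact IsDbarStar.zero
    · rw [dbar_zero, add_zero]

end

/-- The space of `∂̄`-harmonic `(p,q)`-forms on `X`: the kernel of the Laplacian
`∂̄ ∂̄* + ∂̄* ∂̄` on `A^{p,q}(X)`. -/
def harmonic (a₀ : ℝ) (P : Matrix (Fin 2) (Fin 2) ℝ) (p q : ℕ) : Submodule ℂ (Form (p + q)) where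
  carrier := {ψ | ψ ∈ A a₀ P p q ∧ IsLaplacian a₀ P p q ψ 0}
  zero_mem' := ⟨zero_mem _, IsLaplacian.zero⟩
  add_mem' := by
    rintro ψ φ ⟨h1, h2⟩ ⟨h1', h2'⟩
    exact ⟨add_mem h1 h1', by simpa using h2.add h1 h1' h2'⟩
  smul_mem' := by
    rintro c ψ ⟨h1, h2⟩
    exact ⟨Submodule.smul_mem _ c h1, by
      have h := h2.smul c h1
      have h0 : c • (0 : Form (p + q)) = 0 := by
        funext x
        ext v
        simp
      rwa [h0] at h⟩

/-- The Hodge number `h^{p,q}_∂̄` of `X`. -/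
def hodgeNumber (a₀ : ℝ) (P : Matrix (Fin 2) (Fin 2) ℝ) (p q : ℕ) : ℕ :=
  Module.finrank ℂ (harmonic a₀ P p q)

end Solvmanifold

end

/-!
Since `X` is compact, a form of type `(p,0)` is harmonic iff it is `∂̄`-closed. In the
left-invariant frame, `∂̄ψ = 0` says that the `∂̄`-derivatives of the coefficients of `ψ` along
`e₁, e₃, e₅` are constant linear combinations of the coefficients, and the matrices of these
combinations are strictly triangular for a suitable ordering of the frame. Each of the three
fields spans, together with its image under `J`, affine complex planes in `G`; a bounded function
on `ℂ` whose `∂̄`-derivative is a constant is itself constant, by Liouville's theorem applied to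
its increments. By induction along the triangular ordering all coefficients are therefore
constant, so that `∂̄ψ = 0` becomes a linear system. Its solutions are spanned by `Φ¹`, `Φ¹ ∧ Φ³`
and `Φ¹ ∧ Φ² ∧ Φ³` for `p = 1, 2, 3`.
-/

noncomputable section

namespace Solvmanifold

section SlotOperators

variable {ι V V' R : Type*} [DecidableEq ι] [CommRing R] {A : V → V} {c : ι → R}
  {s : Finset ι} {l : ι}

/-- The operator on functions of a family of vectors that precomposes the `l`-th slot with `A`. -/
def slotOp (A : V → V) (l : ι) : ((ι → V) → R) →ₗ[R] ((ι → V) → R) :=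
  LinearMap.funLeft R R fun v => Function.update v l (A (v l))

/-- The product over `l ∈ s` of the commuting operators `1 + c l • slotOp A l`, expanded; up to the
factor `2⁻ᵏ` this is the operator that defines `mixedPart`. -/
def slotSum (A : V → V) (c : ι → R) (s : Finset ι) : ((ι → V) → R) →ₗ[R] ((ι → V) → R) :=
  ∑ T ∈ s.powerset, (∏ j ∈ T, c j) • LinearMap.funLeft R R fun v => T.piecewise (fun j => A (v j)) v

theorem slotOp_apply (h : (ι → V) → R) (v : ι → V) :
    slotOp A l h v = h (Function.update v l (A (v l))) := rfl

theorem slotSum_apply (h : (ι → V) → R) (v : ι → V) :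
    slotSum A c s h v =
      ∑ T ∈ s.powerset, (∏ j ∈ T, c j) * h (T.piecewise (fun j => A (v j)) v) := by
  simp [slotSum, LinearMap.funLeft_apply]

@[simp]
theorem slotSum_empty (h : (ι → V) → R) : slotSum A c ∅ h = h := by
  ext v
  simp [slotSum_apply]

theorem piecewise_update_comp {T : Finset ι} (hl : l ∉ T) (v : ι → V) (u : V) :
    T.piecewise (fun j => A (Function.update v l u j)) (Function.update v l u) =
      Function.update (T.piecewise (fun j => A (v j)) v) l u := by
  funext j
  rcases eq_or_ne j l with rfl | hj
  · simp [hl]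
  · simp [Finset.piecewise, hj]

theorem slotSum_slotOp (hl : l ∉ s) (h : (ι → V) → R) :
    slotSum A c s (slotOp A l h) = slotOp A l (slotSum A c s h) := by
  ext v
  rw [slotOp_apply, slotSum_apply, slotSum_apply]
  refine Finset.sum_congr rfl fun T hT => ?_
  have hlT : l ∉ T := fun hlT => hl (Finset.mem_powerset.1 hT hlT)
  rw [piecewise_update_comp hlT, slotOp_apply, Finset.piecewise_eq_of_notMem _ _ _ hlT]

theorem slotSum_insert (hl : l ∉ s) (h : (ι → V) → R) :
    slotSum A c (insert l s) h = slotSum A c s (h + c l • slotOp A l h) := by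
  ext v
  rw [map_add, map_smul, Pi.add_apply, Pi.smul_apply, slotSum_apply,
    Finset.sum_powerset_insert hl, ← slotSum_apply, slotSum_apply h, slotSum_apply (slotOp A l h),
    smul_eq_mul, Finset.mul_sum]
  congr 1
  refine Finset.sum_congr rfl fun T hT => ?_
  have hlT : l ∉ T := fun hlT => hl (Finset.mem_powerset.1 hT hlT)
  rw [Finset.prod_insert hlT, Finset.piecewise_insert, mul_assoc, slotOp_apply,
    Finset.piecewise_eq_of_notMem _ _ _ hlT]

theorem slotSum_congr {c' : ι → R} (hc : ∀ l ∈ s, c l = c' l) :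
    slotSum A c s = slotSum A c' s := by
  refine Finset.sum_congr rfl fun T hT => ?_
  rw [Finset.prod_congr rfl fun l hl => hc l (Finset.mem_powerset.1 hT hl)]

theorem slotSum_of_forall_smul_slotOp_eq {h : (ι → V) → R} (hh : ∀ l ∈ s, c l • slotOp A l h = h) :
    slotSum A c s h = 2 ^ s.card • h := by
  induction s using Finset.induction_on with
  | empty => simp
  | insert l s hl ih =>
    rw [slotSum_insert hl, hh l (Finset.mem_insert_self l s), map_add,
      ih fun j hj => hh j (Finset.mem_insert_of_mem hj), Finset.card_insert_of_notMem hl, pow_succ,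
      mul_smul, two_smul, smul_add]

theorem smul_slotOp_slotSum (hl : l ∈ s) (hc : c l * c l = -1) {h : (ι → V) → R}
    (hh : slotOp A l (slotOp A l h) = -h) :
    c l • slotOp A l (slotSum A c s h) = slotSum A c s h := by
  obtain ⟨t, ht, rfl⟩ : ∃ t, l ∉ t ∧ s = insert l t :=
    ⟨s.erase l, Finset.notMem_erase l s, (Finset.insert_erase hl).symm⟩
  rw [slotSum_insert ht, ← slotSum_slotOp ht, ← map_smul]
  congr 1
  rw [map_add, map_smul, hh, smul_add, smul_smul, hc, neg_smul, one_smul, neg_neg, add_comm]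

theorem slotSum_comp {A' : V' → V'} {L : V → V'} (hL : ∀ v, A' (L v) = L (A v))
    (h : (ι → V') → R) (v : ι → V) :
    slotSum A' c s h (fun j => L (v j)) = slotSum A c s (fun v => h fun j => L (v j)) v := by
  rw [slotSum_apply, slotSum_apply]
  refine Finset.sum_congr rfl fun T _ => ?_
  congr 2
  funext j
  by_cases hj : j ∈ T <;> simp [hj, hL]

theorem slotSum_erase_zero_cons {p : ℕ} {c : Fin (p + 1) → R} (h : (Fin (p + 1) → V) → R)
    (u : V) (w : Fin p → V) :
    slotSum A c (Finset.univ.erase 0) h (Fin.cons u w) =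
      slotSum A (Fin.tail c) Finset.univ (fun w => h (Fin.cons u w)) w := by
  have key (s : Finset (Fin p)) : slotSum A c (s.map (Fin.succEmb p)) h (Fin.cons u w) =
      slotSum A (Fin.tail c) s (fun w => h (Fin.cons u w)) w := by
    induction s using Finset.induction_on generalizing h with
    | empty => simp
    | insert l s hl ih =>
      rw [Finset.map_insert, slotSum_insert (by simpa using hl), slotSum_insert hl, ih]
      refine congrFun (congrArg _ (funext fun w => ?_)) w
      simp [slotOp_apply, Fin.tail, Fin.cons_update]
  rw [← key, Fin.univ_succ, Finset.erase_cons]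
  rfl

end SlotOperators

section ComplexSlots

variable {ι V : Type*} [DecidableEq ι]

/-- Complex linearity of `h` in every slot, for the complex structure `A` on the space of vectors.
The alternating forms with this property are those of type `(k, 0)`. -/
def IsSlotwiseComplexLinear (A : V → V) (h : (ι → V) → ℂ) : Prop :=
  ∀ l, slotOp A l h = Complex.I • h

variable {A : V → V} {h : (ι → V) → ℂ}

theorem IsSlotwiseComplexLinear.map_update (hh : IsSlotwiseComplexLinear A h) (v : ι → V) (l : ι)
    (z : V) : h (Function.update v l (A z)) = Complex.I * h (Function.update v l z) := by
  simpa [slotOp_apply] using congrFun (hh l) (Function.update v l z)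

theorem neg_I_smul_I_smul {M : Type*} [AddCommGroup M] [Module ℂ M] (x : M) :
    (-Complex.I) • Complex.I • x = x := by
  simp [smul_smul]

variable [Fintype ι]

theorem IsSlotwiseComplexLinear.slotSum_neg_I (hh : IsSlotwiseComplexLinear A h) :
    slotSum A (fun _ => -Complex.I) Finset.univ h = 2 ^ Fintype.card ι • h :=
  slotSum_of_forall_smul_slotOp_eq fun l _ => by rw [hh l, neg_I_smul_I_smul]

theorem IsSlotwiseComplexLinear.slotSum_neg_I_update (hh : IsSlotwiseComplexLinear A h) (m : ι)
    (N : V → V) (w : ι → V) :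
    2 * slotSum A (fun _ => -Complex.I) Finset.univ
        (fun w => h (Function.update w m (N (w m)))) w =
      2 ^ Fintype.card ι * (h (Function.update w m (N (w m))) -
        Complex.I * h (Function.update w m (N (A (w m))))) := by
  have hne : ∀ l ∈ Finset.univ.erase m, (-Complex.I) • slotOp A l (slotOp N m h) =
      slotOp N m h := by
    intro l hl
    have hlm : l ≠ m := Finset.ne_of_mem_erase hl
    ext v
    simp only [Pi.smul_apply, slotOp_apply, Function.update_of_ne hlm.symm]
    rw [Function.update_comm hlm, hh.map_update, smul_eq_mul, ← mul_assoc, neg_mul,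
      Complex.I_mul_I, neg_neg, one_mul, Function.update_comm hlm.symm, Function.update_eq_self]
  have hcard : Fintype.card ι = (Finset.univ.erase m).card + 1 := by
    rw [Finset.card_erase_add_one (Finset.mem_univ m), Finset.card_univ]
  change 2 * slotSum A (fun _ => -Complex.I) Finset.univ (slotOp N m h) w = _
  rw [← Finset.insert_erase (Finset.mem_univ m), slotSum_insert (Finset.notMem_erase _ _),
    map_add, map_smul, slotSum_slotOp (Finset.notMem_erase _ _),
    slotSum_of_forall_smul_slotOp_eq hne, hcard, pow_succ]
  simp [slotOp_apply]
  ring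

end ComplexSlots

section Types

variable {k : ℕ} {A : E →L[ℝ] E}

theorem mixedPart_eq_slotSum (S : Finset (Fin k)) (α : E [⋀^Fin k]→L[ℝ] ℂ) (v : Fin k → E) :
    mixedPart A S α v = (1 / 2 : ℂ) ^ k *
      slotSum A (fun j => if j ∈ S then -Complex.I else Complex.I) Finset.univ α v := by
  rw [mixedPart_apply, slotSum_apply, Finset.powerset_univ]
  rfl

theorem slotOp_slotOp_alternating (hA : ∀ v, A (A v) = -v) (α : E [⋀^Fin k]→L[ℝ] ℂ) (l : Fin k) :
    slotOp A l (slotOp A l α) = -⇑α := by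
  ext v
  simpa [slotOp_apply, hA] using α.map_update_smul v l (-1) (v l)

theorem mixedPart_update (hA : ∀ v, A (A v) = -v) (S : Finset (Fin k))
    (α : E [⋀^Fin k]→L[ℝ] ℂ) (v : Fin k → E) (l : Fin k) :
    mixedPart A S α (Function.update v l (A (v l))) =
      (if l ∈ S then Complex.I else -Complex.I) * mixedPart A S α v := by
  have h := congrFun (smul_slotOp_slotSum (c := fun j => if j ∈ S then -Complex.I else Complex.I)
    (Finset.mem_univ l) (by by_cases hl : l ∈ S <;> simp [hl])
    (slotOp_slotOp_alternating hA α l)) v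
  rw [mixedPart_eq_slotSum, mixedPart_eq_slotSum, ← h]
  by_cases hl : l ∈ S <;> simp [hl, slotOp_apply, mul_left_comm Complex.I, ← mul_assoc Complex.I]

theorem typeProj_self_apply (α : E [⋀^Fin k]→L[ℝ] ℂ) (v : Fin k → E) :
    typeProj A k α v = mixedPart A Finset.univ α v := by
  have h : Finset.powersetCard k (Finset.univ : Finset (Fin k)) = {Finset.univ} := by
    simpa only [Finset.card_fin] using Finset.powersetCard_self (Finset.univ : Finset (Fin k))
  rw [typeProj_apply, h, Finset.sum_singleton]

theorem typeProj_self_eq_iff (hA : ∀ v, A (A v) = -v) (α : E [⋀^Fin k]→L[ℝ] ℂ) :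
    typeProj A k α = α ↔ IsSlotwiseComplexLinear A α := by
  constructor
  · intro h l
    ext v
    rw [slotOp_apply, ← h, typeProj_self_apply, mixedPart_update hA, Pi.smul_apply,
      typeProj_self_apply]
    simp
  · intro h
    ext v
    rw [typeProj_self_apply, mixedPart_eq_slotSum]
    simp [h.slotSum_neg_I]

theorem mixedPart_map_perm (σ : Equiv.Perm (Fin k)) (S : Finset (Fin k))
    (α : E [⋀^Fin k]→L[ℝ] ℂ) (v : Fin k → E) :
    mixedPart A (S.map σ.toEmbedding) α v =
      Equiv.Perm.sign σ • mixedPart A S α (v ∘ σ) := by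
  rw [mixedPart_apply, mixedPart_apply, ← mul_smul_comm, Finset.smul_sum]
  congr 1
  refine (Fintype.sum_equiv (Equiv.finsetCongr σ) _ _ fun T => ?_).symm
  have h := α.toAlternatingMap.map_perm
    (fun l => if l ∈ T.map σ.toEmbedding then A (v l) else v l) σ
  have hσ : (fun l => if l ∈ T.map σ.toEmbedding then A (v l) else v l) ∘ σ =
      fun l => if l ∈ T then A ((v ∘ σ) l) else (v ∘ σ) l := by
    funext l
    simp
  rw [hσ] at h
  change α _ = _ • α _ at h
  rw [h, Equiv.finsetCongr_apply, Finset.prod_map, mul_smul_comm, smul_smul,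
    Int.units_mul_self, one_smul]
  simp

theorem typeProj_codim_one_apply {p : ℕ} (β : E [⋀^Fin (p + 1)]→L[ℝ] ℂ) (v : Fin (p + 1) → E) :
    typeProj A p β v = ∑ l, mixedPart A (Finset.univ.erase l) β v := by
  have h : Finset.powersetCard p (Finset.univ : Finset (Fin (p + 1))) =
      Finset.univ.image fun l => Finset.univ.erase l := by
    ext S
    have hS : S.card = p ↔ Sᶜ.card = 1 := by
      have := S.card_add_card_compl
      rw [Fintype.card_fin] at this
      omega
    simp only [Finset.mem_powersetCard_univ, hS, Finset.card_eq_one, Finset.mem_image,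
      Finset.mem_univ, true_and, ← Finset.compl_singleton]
    exact exists_congr fun _ => compl_eq_comm
  rw [typeProj_apply, h, Finset.sum_image fun l _ m _ hlm => ?_]
  simpa only [← Finset.compl_singleton, compl_inj_iff, Finset.singleton_inj] using hlm

theorem mixedPart_erase_zero_eq_zero {p : ℕ} (hA : ∀ v, A (A v) = -v)
    {β : E [⋀^Fin (p + 1)]→L[ℝ] ℂ} (h : typeProj A p β = 0) (v : Fin (p + 1) → E) :
    mixedPart A (Finset.univ.erase 0) β v = 0 := by
  have hsum (v : Fin (p + 1) → E) : ∑ l, mixedPart A (Finset.univ.erase l) β v = 0 := by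
    rw [← typeProj_codim_one_apply, h]
    rfl
  have h₁ := hsum v
  have h₂ := hsum (Function.update v 0 (A (v 0)))
  simp only [mixedPart_update hA, Finset.mem_erase, Finset.mem_univ, and_true] at h₂
  rw [Fin.sum_univ_succ] at h₁ h₂
  simp only [ne_eq, not_true_eq_false, if_false, (Fin.succ_ne_zero _).symm, not_false_eq_true,
    if_true, ← Finset.mul_sum] at h₂
  have h₃ : Complex.I * mixedPart A (Finset.univ.erase 0) β v = 0 := by
    linear_combination (1 / 2) * Complex.I * h₁ - (1 / 2) * h₂
  simpa using h₃

theorem typeProj_codim_one_eq_zero_iff {p : ℕ} (hA : ∀ v, A (A v) = -v)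
    (β : E [⋀^Fin (p + 1)]→L[ℝ] ℂ) :
    typeProj A p β = 0 ↔ ∀ v, mixedPart A (Finset.univ.erase 0) β v = 0 := by
  refine ⟨mixedPart_erase_zero_eq_zero hA, fun h => ?_⟩
  ext v
  rw [typeProj_codim_one_apply]
  refine Finset.sum_eq_zero fun l _ => ?_
  have hl : (Finset.univ.erase 0).map (Equiv.swap 0 l).toEmbedding = Finset.univ.erase l := by
    simp [Finset.map_erase]
  rw [← hl, mixedPart_map_perm, h, smul_zero]

theorem mixedPart_erase_zero_apply {p : ℕ} (β : E [⋀^Fin (p + 1)]→L[ℝ] ℂ) (u : E)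
    (w : Fin p → E) :
    mixedPart A (Finset.univ.erase 0) β (Fin.cons u w) = (1 / 2 : ℂ) ^ (p + 1) *
      slotSum A (fun _ => -Complex.I) Finset.univ
        (fun w => β (Fin.cons u w) + Complex.I * β (Fin.cons (A u) w)) w := by
  have hc : slotSum A (fun j : Fin (p + 1) => if j ∈ Finset.univ.erase 0 then -Complex.I
      else Complex.I) (Finset.univ.erase 0) = slotSum (R := ℂ) A (fun _ => -Complex.I)
        (Finset.univ.erase 0) :=
    slotSum_congr fun l hl => if_pos hl
  have hs (c : Fin (p + 1) → ℂ) (h : (Fin (p + 1) → E) → ℂ) : slotSum A c Finset.univ h =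
      slotSum A c (Finset.univ.erase 0) (h + c 0 • slotOp A 0 h) := by
    rw [← slotSum_insert (Finset.notMem_erase _ _), Finset.insert_erase (Finset.mem_univ 0)]
  rw [mixedPart_eq_slotSum, hs, hc, slotSum_erase_zero_cons]
  simp [slotOp_apply, Fin.tail_def]

end Types

section Frame

/-- The differential of the left translation by `g`, which maps the standard basis of `ℝ⁶` to the
left-invariant frame at `g`. -/
def frameMap (g : E) : E →L[ℝ] E :=
  ∑ i, (dcoord i).smulRight (frame g i)

theorem frameMap_apply (g w : E) : frameMap g w =
    ![w 0, w 1,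
      Real.exp (g 0) * w 2 + g 1 * Real.exp (g 0) * w 4,
      Real.exp (-g 0) * w 3 + g 1 * Real.exp (-g 0) * w 5,
      Real.exp (g 0) * w 4, Real.exp (-g 0) * w 5] := by
  funext i
  fin_cases i <;> simp [frameMap, Fin.sum_univ_succ, dcoord, frame] <;> ring

theorem frameMap_single (g : E) (i : Fin 6) : frameMap g (Pi.single i 1) = frame g i := by
  simp [frameMap, dcoord, Pi.single_apply]

theorem frameMap_surjective (g : E) : Function.Surjective (frameMap g) := by
  intro v
  refine ⟨fun i => coframe g i v, ?_⟩
  rw [frameMap_apply]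
  funext i
  fin_cases i <;> simp [coframe, dcoord, Real.exp_neg] <;> field_simp <;> ring

theorem leftMul_eq_add (g h : E) : leftMul g h = g + frameMap g h := by
  rw [frameMap_apply]
  funext i
  fin_cases i <;> simp [leftMul] <;> ring

theorem hasFDerivAt_leftMul (g x : E) : HasFDerivAt (leftMul g) (frameMap g) x := by
  rw [funext (leftMul_eq_add g)]
  exact (frameMap g).hasFDerivAt.const_add g

theorem frameMap_leftMul (g x w : E) :
    frameMap (leftMul g x) w = frameMap g (frameMap x w) := by
  simp only [frameMap_apply]
  funext i
  fin_cases i <;> simp [leftMul, Real.exp_add] <;> ring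

theorem contDiff_frameMap_apply (w : E) : ContDiff ℝ ∞ fun x => frameMap x w := by
  simp only [frameMap_apply]
  refine contDiff_pi.2 fun i => ?_
  fin_cases i <;> simp only [Fin.zero_eta, Fin.mk_one, Fin.reduceFinMk, Matrix.cons_val] <;>
    fun_prop

theorem differentiable_frameMap_apply (w : E) : Differentiable ℝ fun x => frameMap x w :=
  (contDiff_frameMap_apply w).differentiable (by simp)

theorem J_zero_apply (w : E) : J 0 w = ![-w 1, w 0, -w 3, w 2, -w 5, w 4] := by
  funext i
  fin_cases i <;> simp [J, coframe, dcoord, frame]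

theorem J_frameMap (g w : E) : J g (frameMap g w) = frameMap g (J 0 w) := by
  simp only [frameMap_apply, J_zero_apply]
  funext i
  fin_cases i <;> simp [J, coframe, dcoord, frame, Real.exp_neg] <;> field_simp <;> ring

/-- The covariant derivative of left-invariant vector fields for the flat connection of `ℝ⁶`; vector
fields are written in the left-invariant frame. -/
def conn (u w : E) : E :=
  ![0, 0, u 0 * w 2 + u 1 * w 4, -(u 0 * w 3) + u 1 * w 5, u 0 * w 4, -(u 0 * w 5)]

theorem fderiv_frameMap_zero (u w : E) : fderiv ℝ (fun y => frameMap y w) 0 u = conn u w := by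
  have hline (i : Fin 6) : DifferentiableAt ℝ (fun t : ℝ => frameMap (0 + t • u) w i) 0 :=
    (differentiable_pi.1 (differentiable_frameMap_apply w) i).comp (by fun_prop) 0
  rw [← (differentiable_frameMap_apply w 0).lineDeriv_eq_fderiv, lineDeriv, deriv_pi hline]
  funext i
  simp only [frameMap_apply]
  fin_cases i <;> simp (disch := fun_prop) [conn]

theorem fderiv_frameMap_apply (x u w : E) :
    fderiv ℝ (fun y => frameMap y w) x (frameMap x u) = frameMap x (conn u w) := by
  have hx : leftMul x 0 = x := by rw [leftMul_eq_add, map_zero, add_zero]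
  have h : HasFDerivAt (fun y => frameMap (leftMul x y) w)
      (fderiv ℝ (fun y => frameMap y w) x ∘L frameMap x) 0 :=
    HasFDerivAt.comp 0 (g := fun y => frameMap y w)
      (by rw [hx]; exact (differentiable_frameMap_apply w x).hasFDerivAt) (hasFDerivAt_leftMul x 0)
  have h' : HasFDerivAt (fun y => frameMap x (frameMap y w))
      (frameMap x ∘L fderiv ℝ (fun y => frameMap y w) 0) 0 :=
    (frameMap x).hasFDerivAt.comp 0 (differentiable_frameMap_apply w 0).hasFDerivAt
  simp only [frameMap_leftMul] at h
  rw [← fderiv_frameMap_zero]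
  exact congrArg (fun L => L u) (h.unique h')

/-- The bracket of left-invariant vector fields, written in the left-invariant frame. -/
def bracket (u w : E) : E := conn u w - conn w u

end Frame

section Dbar

theorem extDeriv_cons {𝕜 F G : Type*} [NontriviallyNormedField 𝕜] [NormedAddCommGroup F]
    [NormedSpace 𝕜 F] [NormedAddCommGroup G] [NormedSpace 𝕜 G] {p : ℕ}
    (ψ : F → F [⋀^Fin p]→L[𝕜] G) (x u : F) (v : Fin p → F) :
    extDeriv ψ x (Fin.cons u v : Fin (p + 1) → F) =
      fderiv 𝕜 ψ x u v - ∑ m, fderiv 𝕜 ψ x (v m) (Function.update v m u) := by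
  rw [extDeriv, ContinuousAlternatingMap.alternatizeUncurryFin_apply, Fin.sum_univ_succ,
    sub_eq_add_neg, ← Finset.sum_neg_distrib]
  congr 1
  · simp
  · refine Finset.sum_congr rfl fun m _ => ?_
    obtain _ | p := p
    · exact m.elim0
    have hremove : m.succ.removeNth (Fin.cons u v : Fin (p + 2) → F) =
        Matrix.vecCons u (m.removeNth v) := by
      funext j
      cases j using Fin.cases <;> simp [Fin.removeNth]
    have hinsert := ContinuousAlternatingMap.neg_one_pow_smul_map_insertNth
      (fderiv 𝕜 ψ x (v m)) m u (m.removeNth v)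
    rw [Fin.insertNth_removeNth] at hinsert
    rw [hremove, Fin.cons_succ, ← hinsert, smul_smul, Fin.val_succ, pow_succ', mul_assoc,
      ← mul_pow]
    simp

variable {p : ℕ}

/-- The coefficient of a form on the left-invariant vector fields given by `w`. -/
def coeff (ψ : Form p) (w : Fin p → E) (x : E) : ℂ := ψ x fun m => frameMap x (w m)

/-- Twice the derivative of `f` along the `(0,1)`-part of the left-invariant field given by `u`. -/
def dbarDeriv (f : E → ℂ) (u x : E) : ℂ :=
  fderiv ℝ f x (frameMap x u) + Complex.I * fderiv ℝ f x (frameMap x (J 0 u))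

/-- The operator `w ↦ [u + iJu, w^{1,0}]^{1,0}` that defines `∂̄` on the bundle of
`(1,0)`-vectors, carried over to real left-invariant fields by `w^{1,0} = (w - iJw) / 2`. -/
def dbarTangent (u w : E) : E :=
  (1 / 2 : ℝ) • (bracket u w + bracket (J 0 u) (J 0 w)
    + J 0 (bracket (J 0 u) w - bracket u (J 0 w)))

/-- The coefficients of `2 ∂̄ψ` for a form `ψ` of type `(p,0)`: the argument `u` enters through its
`(0,1)`-part, the arguments `w` through their `(1,0)`-parts. -/
def dbarCoeff (ψ : Form p) (u : E) (w : Fin p → E) (x : E) : ℂ :=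
  dbarDeriv (coeff ψ w) u x - ∑ m, coeff ψ (Function.update w m (dbarTangent u (w m))) x

theorem frameMap_update (x : E) (w : Fin p → E) (m : Fin p) (z : E) :
    (fun j => frameMap x (Function.update w m z j)) =
      Function.update (fun j => frameMap x (w j)) m (frameMap x z) :=
  funext fun j => Function.apply_update (fun _ => frameMap x) w m z j

theorem coeff_update (ψ : Form p) (w : Fin p → E) (m : Fin p) (z x : E) :
    coeff ψ (Function.update w m z) x =
      ψ x (Function.update (fun j => frameMap x (w j)) m (frameMap x z)) := by
  rw [coeff, frameMap_update]

theorem coeff_update_add (ψ : Form p) (w : Fin p → E) (m : Fin p) (z z' x : E) :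
    coeff ψ (Function.update w m (z + z')) x =
      coeff ψ (Function.update w m z) x + coeff ψ (Function.update w m z') x := by
  simp only [coeff_update, map_add, ContinuousAlternatingMap.map_update_add]

theorem coeff_update_sub (ψ : Form p) (w : Fin p → E) (m : Fin p) (z z' x : E) :
    coeff ψ (Function.update w m (z - z')) x =
      coeff ψ (Function.update w m z) x - coeff ψ (Function.update w m z') x := by
  simp only [coeff_update, map_sub, ContinuousAlternatingMap.map_update_sub]

theorem coeff_update_smul (ψ : Form p) (w : Fin p → E) (m : Fin p) (r : ℝ) (z x : E) :
    coeff ψ (Function.update w m (r • z)) x = r * coeff ψ (Function.update w m z) x := by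
  simp only [coeff_update, map_smul, ContinuousAlternatingMap.map_update_smul, Complex.real_smul]

theorem isSlotwiseComplexLinear_coeff {ψ : Form p} {x : E}
    (hJ : IsSlotwiseComplexLinear (J x) (ψ x)) :
    IsSlotwiseComplexLinear (J 0) fun w => coeff ψ w x := by
  intro l
  ext w
  rw [slotOp_apply, coeff_update, ← J_frameMap]
  exact congrFun (hJ l) fun j => frameMap x (w j)

theorem differentiable_coeff {ψ : Form p} (hψ : Differentiable ℝ ψ) (w : Fin p → E) :
    Differentiable ℝ (coeff ψ w) := fun x =>
  ((hψ x).hasFDerivAt.continuousAlternatingMap_apply (g := fun m y => frameMap y (w m))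
    fun m => (differentiable_frameMap_apply (w m) x).hasFDerivAt).differentiableAt

theorem fderiv_coeff {ψ : Form p} (hψ : Differentiable ℝ ψ) (x u : E) (w : Fin p → E) :
    fderiv ℝ (coeff ψ w) x (frameMap x u) =
      fderiv ℝ ψ x (frameMap x u) (fun j => frameMap x (w j)) +
        ∑ m, coeff ψ (Function.update w m (conn u (w m))) x := by
  have h := fderiv_continuousAlternatingMap_apply_apply (f := ψ) (x := x)
    (g := fun m y => frameMap y (w m)) (hψ x)
    (fun m => differentiable_frameMap_apply (w m) x) (frameMap x u)
  simp only [fderiv_frameMap_apply] at h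
  simp only [coeff_update]
  exact h

variable {ψ : Form p} (hJ : ∀ x, IsSlotwiseComplexLinear (J x) (ψ x))

include hJ

theorem coeff_update_J (w : Fin p → E) (l : Fin p) (z x : E) :
    coeff ψ (Function.update w l (J 0 z)) x = Complex.I * coeff ψ (Function.update w l z) x :=
  (isSlotwiseComplexLinear_coeff (hJ x)).map_update w l z

theorem sum_erase_coeff_update_update_J (w : Fin p → E) (m : Fin p) (N : E → E) (u x : E) :
    ∑ n ∈ Finset.univ.erase m, coeff ψ (Function.update (Function.update w m (J 0 u)) n
        (N (Function.update w m (J 0 u) n))) x =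
      Complex.I * ∑ n ∈ Finset.univ.erase m, coeff ψ (Function.update (Function.update w m u) n
        (N (Function.update w m u n))) x := by
  rw [Finset.mul_sum]
  refine Finset.sum_congr rfl fun n hn => ?_
  have hnm := Finset.ne_of_mem_erase hn
  rw [Function.update_of_ne hnm, Function.update_of_ne hnm, Function.update_comm hnm.symm,
    Function.update_comm hnm.symm, coeff_update_J hJ]

variable (hψ : Differentiable ℝ ψ)

include hψ

theorem fderiv_update_J (x z : E) (w : Fin p → E) (m : Fin p) (u : E) :
    fderiv ℝ ψ x (frameMap x z) (fun j => frameMap x (Function.update w m (J 0 u) j)) =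
      Complex.I * (fderiv ℝ ψ x (frameMap x z) (fun j => frameMap x (Function.update w m u j)) +
        coeff ψ (Function.update w m (conn z u)) x) -
      coeff ψ (Function.update w m (conn z (J 0 u))) x := by
  have hcoeff : coeff ψ (Function.update w m (J 0 u)) =
      fun y => Complex.I * coeff ψ (Function.update w m u) y :=
    funext fun y => coeff_update_J hJ w m u y
  have hsum (u' : E) := Finset.add_sum_erase Finset.univ (fun n => coeff ψ
    (Function.update (Function.update w m u') n (conn z (Function.update w m u' n))) x)
    (Finset.mem_univ m)
  simp only [Function.update_self, Function.update_idem] at hsum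
  have h := fderiv_coeff hψ x z (Function.update w m u)
  have h' := fderiv_coeff hψ x z (Function.update w m (J 0 u))
  rw [hcoeff, fderiv_const_mul (differentiable_coeff hψ _ x), smul_apply, smul_eq_mul, h,
    ← hsum, ← hsum, sum_erase_coeff_update_update_J hJ] at h'
  linear_combination -h'

theorem extDeriv_cons_add_I_mul (x u : E) (w : Fin p → E) :
    extDeriv ψ x (Fin.cons (frameMap x u) (fun j => frameMap x (w j)) : Fin (p + 1) → E) +
      Complex.I * extDeriv ψ x
        (Fin.cons (J x (frameMap x u)) (fun j => frameMap x (w j)) : Fin (p + 1) → E) =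
    dbarDeriv (coeff ψ w) u x - ∑ m, coeff ψ (Function.update w m
      (bracket u (w m) + J 0 (bracket (J 0 u) (w m)))) x := by
  have hm (m : Fin p) : coeff ψ (Function.update w m
        (bracket u (w m) + J 0 (bracket (J 0 u) (w m)))) x =
      coeff ψ (Function.update w m (conn u (w m))) x
        + Complex.I * coeff ψ (Function.update w m (conn (J 0 u) (w m))) x
        + (fderiv ℝ ψ x (frameMap x (w m)) (fun j => frameMap x (Function.update w m u j)) +
          Complex.I * fderiv ℝ ψ x (frameMap x (w m))
            (fun j => frameMap x (Function.update w m (J 0 u) j))) := by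
    rw [fderiv_update_J hJ hψ, coeff_update_add, coeff_update_J hJ, bracket, bracket,
      coeff_update_sub, coeff_update_sub]
    linear_combination (-fderiv ℝ ψ x (frameMap x (w m))
      (fun j => frameMap x (Function.update w m u j)) -
      coeff ψ (Function.update w m (conn (w m) u)) x) * Complex.I_mul_I
  rw [J_frameMap, extDeriv_cons, extDeriv_cons, dbarDeriv, fderiv_coeff hψ, fderiv_coeff hψ,
    Finset.sum_congr rfl fun m _ => hm m]
  simp only [← frameMap_update, Finset.sum_add_distrib, ← Finset.mul_sum]
  ring

theorem dbarDeriv_coeff_slotSum (x u : E) (w : Fin p → E) :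
    slotSum (J 0) (fun _ => -Complex.I) Finset.univ (fun w => dbarDeriv (coeff ψ w) u x) w =
      2 ^ p * dbarDeriv (coeff ψ w) u x := by
  have h : IsSlotwiseComplexLinear (J 0) fun w => dbarDeriv (coeff ψ w) u x := by
    intro l
    ext w
    have hcoeff : coeff ψ (Function.update w l (J 0 (w l))) = fun x => Complex.I * coeff ψ w x :=
      funext fun y => by rw [coeff_update_J hJ, Function.update_eq_self]
    rw [slotOp_apply, hcoeff, dbarDeriv, fderiv_const_mul (differentiable_coeff hψ _ x)]
    simp only [smul_apply, smul_eq_mul, dbarDeriv, Pi.smul_apply]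
    ring
  simp [h.slotSum_neg_I]

theorem mixedPart_extDeriv (x u : E) (w : Fin p → E) :
    mixedPart (J x) (Finset.univ.erase 0) (extDeriv ψ x)
        (Fin.cons (frameMap x u) fun j => frameMap x (w j)) =
      1 / 2 * dbarCoeff ψ u w x := by
  have htangent (m : Fin p) :
      slotSum (J 0) (fun _ => -Complex.I) Finset.univ (fun w => coeff ψ
          (Function.update w m (bracket u (w m) + J 0 (bracket (J 0 u) (w m)))) x) w =
        2 ^ p * coeff ψ (Function.update w m (dbarTangent u (w m))) x := by
    have h := (isSlotwiseComplexLinear_coeff (hJ x)).slotSum_neg_I_update m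
      (fun z => bracket u z + J 0 (bracket (J 0 u) z)) w
    rw [Fintype.card_fin] at h
    simp only [dbarTangent, coeff_update_smul, coeff_update_add, coeff_update_sub,
      coeff_update_J hJ] at h ⊢
    push_cast
    linear_combination (1 / 2) * h - (1 / 2) * 2 ^ p *
      coeff ψ (Function.update w m (bracket (J 0 u) (J 0 (w m)))) x * Complex.I_mul_I
  have hsplit : (fun w : Fin p → E => dbarDeriv (coeff ψ w) u x - ∑ m, coeff ψ
      (Function.update w m (bracket u (w m) + J 0 (bracket (J 0 u) (w m)))) x) =
      (fun w => dbarDeriv (coeff ψ w) u x) - ∑ m, fun w => coeff ψ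
        (Function.update w m (bracket u (w m) + J 0 (bracket (J 0 u) (w m)))) x := by
    ext w
    simp
  rw [mixedPart_erase_zero_apply, slotSum_comp (J_frameMap x)]
  simp only [extDeriv_cons_add_I_mul hJ hψ]
  rw [hsplit, map_sub, map_sum, Pi.sub_apply, Finset.sum_apply,
    dbarDeriv_coeff_slotSum hJ hψ, Finset.sum_congr rfl fun m _ => htangent m, ← Finset.mul_sum,
    ← mul_sub, ← dbarCoeff, pow_succ, mul_comm ((1 / 2 : ℂ) ^ p), mul_assoc, ← mul_assoc (_ ^ p),
    ← mul_pow]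
  norm_num

end Dbar

theorem dbar_eq_zero_iff {p : ℕ} {ψ : Form (p + 0)} (hψ : Differentiable ℝ ψ)
    (hJ : ∀ x, IsSlotwiseComplexLinear (J x) (ψ x)) (x : E) :
    dbar p 0 ψ x = 0 ↔ ∀ u w, dbarCoeff ψ u w x = 0 := by
  refine (typeProj_codim_one_eq_zero_iff (p := p) (J_J x) (extDeriv ψ x)).trans ?_
  constructor
  · intro h u w
    have hmixed := h (Fin.cons (frameMap x u) fun j => frameMap x (w j))
    rw [mixedPart_extDeriv (p := p) hJ hψ] at hmixed
    simpa using hmixed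
  · intro h v
    choose w hw using fun j => frameMap_surjective x (v j)
    have hv : v = Fin.cons (frameMap x (w 0)) fun j => frameMap x (Fin.tail w j) := by
      funext j
      cases j using Fin.cases <;> simp [hw, Fin.tail]
    rw [hv, mixedPart_extDeriv (p := p) hJ hψ, h, mul_zero]

section Cover

theorem semiconjBy_map_zpow {G H M : Type*} [Group G] [Group H] [Monoid M] {a : M} {x : G} {y : H}
    (f : G →* M) (g : H →* M) (h : SemiconjBy a (f x) (g y)) (n : ℤ) :
    SemiconjBy a (f (x ^ n)) (g (y ^ n)) := by
  have hunits := SemiconjBy.units_zpow_right (x := f.toHomUnits x) (y := g.toHomUnits y) h n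
  rwa [← map_zpow, ← map_zpow] at hunits

/-- The one-parameter group `t ↦ diag(eᵗ, e⁻ᵗ)` by which the coordinate `t` of `G` acts. -/
def expDiagonal : Multiplicative ℝ →* Matrix (Fin 2) (Fin 2) ℝ where
  toFun t := Matrix.diagonal ![Real.exp t.toAdd, Real.exp (-t.toAdd)]
  map_one' := by
    rw [← Matrix.diagonal_one]
    congr 1
    funext i
    fin_cases i <;> simp
  map_mul' s t := by
    rw [Matrix.diagonal_mul_diagonal]
    congr 1
    funext i
    fin_cases i <;> simp [← Real.exp_add, add_comm]

theorem expDiagonal_mulVec (t : ℝ) (v : Fin 2 → ℝ) :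
    (expDiagonal (Multiplicative.ofAdd t)).mulVec v =
      ![Real.exp t * v 0, Real.exp (-t) * v 1] := by
  ext i
  fin_cases i <;> simp [expDiagonal, Matrix.mulVec_diagonal]

theorem exists_mulVec_mulVec_add_mulVec_intCast_eq {ι : Type*} [Fintype ι] [DecidableEq ι]
    {D P : Matrix ι ι ℝ} {C : Matrix ι ι ℤ} (hD : IsUnit D) (hP : IsUnit P)
    (h : P * C.map (Int.cast : ℤ → ℝ) = D * P) (z : ι → ℝ) :
    ∃ (k : ι → ℤ) (s : ι → ℝ), (∀ i, 0 ≤ s i ∧ s i < 1) ∧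
      D.mulVec (P.mulVec s) + P.mulVec (fun i => (k i : ℝ)) = z := by
  obtain ⟨r, rfl⟩ := Matrix.mulVec_surjective_iff_isUnit.2 (hD.mul hP) z
  refine ⟨C.mulVec fun i => ⌊r i⌋, fun i => Int.fract (r i),
    fun i => ⟨Int.fract_nonneg _, Int.fract_lt_one _⟩, ?_⟩
  have hcast : (fun i => ((C.mulVec (fun i => ⌊r i⌋) i : ℤ) : ℝ)) =
      (C.map (Int.cast : ℤ → ℝ)).mulVec fun i => (⌊r i⌋ : ℝ) :=
    funext fun i => RingHom.map_mulVec (Int.castRingHom ℝ) C _ i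
  rw [hcast, Matrix.mulVec_mulVec, Matrix.mulVec_mulVec, h, ← Matrix.mulVec_add]
  congr 1
  exact funext fun i => Int.fract_add_floor (r i)

/-- The `Γ`-translates of the fundamental domain cover `G`. -/
def TranslatesCover (a₀ : ℝ) (P : Matrix (Fin 2) (Fin 2) ℝ) : Prop :=
  ∀ x, ∃ g ∈ lattice a₀ P, ∃ d ∈ fundDomain a₀ P, leftMul g d = x

variable {B : Matrix.SpecialLinearGroup (Fin 2) ℤ} {a₀ : ℝ} {P : Matrix (Fin 2) (Fin 2) ℝ}

theorem mul_zpow_map_intCast (hP : IsUnit P.det)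
    (hB : P * (B : Matrix (Fin 2) (Fin 2) ℤ).map (Int.cast : ℤ → ℝ) * P⁻¹ =
      Matrix.diagonal ![Real.exp a₀, Real.exp (-a₀)]) (n : ℤ) :
    P * (B ^ n : Matrix.SpecialLinearGroup (Fin 2) ℤ).1.map (Int.cast : ℤ → ℝ) =
      expDiagonal (Multiplicative.ofAdd (a₀ * n)) * P := by
  have hsemiconj : SemiconjBy P
      ((MonoidHomClass.toMonoidHom (Int.castRingHom ℝ).mapMatrix).comp
        Matrix.SpecialLinearGroup.coeMonoidHom B) (expDiagonal (Multiplicative.ofAdd a₀)) := by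
    change P * (B : Matrix (Fin 2) (Fin 2) ℤ).map (Int.cast : ℤ → ℝ) = Matrix.diagonal _ * P
    rw [toAdd_ofAdd, ← hB, Matrix.mul_assoc, Matrix.nonsing_inv_mul _ hP, Matrix.mul_one]
  have hpow := semiconjBy_map_zpow _ _ hsemiconj n
  rwa [← ofAdd_zsmul, zsmul_eq_mul, mul_comm] at hpow

theorem translatesCover (ha₀ : a₀ ≠ 0) (hP : IsUnit P.det)
    (hB : P * (B : Matrix (Fin 2) (Fin 2) ℤ).map (Int.cast : ℤ → ℝ) * P⁻¹ =
      Matrix.diagonal ![Real.exp a₀, Real.exp (-a₀)]) : TranslatesCover a₀ P := by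
  intro x
  set n : ℤ := ⌊x 0 / a₀⌋
  set m : ℤ := ⌊x 1⌋
  have hDP := exists_mulVec_mulVec_add_mulVec_intCast_eq ((Group.isUnit _).map expDiagonal)
    ((Matrix.isUnit_iff_isUnit_det P).2 hP) (mul_zpow_map_intCast hP hB n)
  simp only [expDiagonal_mulVec] at hDP
  obtain ⟨k, s, hs, hz⟩ := hDP ![x 4, x 5]
  obtain ⟨l, r, hr, hy⟩ := hDP (![x 2, x 3] - (m : ℝ) •
    ![Real.exp (a₀ * n) * P.mulVec s 0, Real.exp (-(a₀ * n)) * P.mulVec s 1])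
  have ht : a₀ * n + a₀ * Int.fract (x 0 / a₀) = x 0 := by
    rw [← mul_add, Int.floor_add_fract, mul_div_cancel₀ _ ha₀]
  have hx : (m : ℝ) + Int.fract (x 1) = x 1 := Int.floor_add_fract _
  have hy₀ := congrFun hy 0
  have hy₁ := congrFun hy 1
  have hz₀ := congrFun hz 0
  have hz₁ := congrFun hz 1
  simp only [Matrix.mulVec_fin_two, Pi.add_apply, Pi.sub_apply,
    Pi.smul_apply, smul_eq_mul, Matrix.cons_val] at hy₀ hy₁ hz₀ hz₁
  refine ⟨_, ⟨![n, m, l 0, l 1, k 0, k 1], rfl⟩, _,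
    ⟨![Int.fract (x 0 / a₀), Int.fract (x 1), r 0, r 1, s 0, s 1], ?_, rfl⟩, ?_⟩
  · simp [Fin.forall_fin_succ, hr, hs, Int.fract_lt_one]
  · funext i
    fin_cases i
    · exact ht
    · exact hx
    all_goals simp only [leftMul, latticeMap, Fin.reduceFinMk, Matrix.cons_val]
    · linear_combination hy₀
    · linear_combination hy₁
    · linear_combination hz₀
    · linear_combination hz₁

end Cover

section Harmonic

variable {a₀ : ℝ} {P : Matrix (Fin 2) (Fin 2) ℝ}

/-- A function on `G` that descends to `X = Γ \ G`. -/
def IsInvariant (a₀ : ℝ) (P : Matrix (Fin 2) (Fin 2) ℝ) (f : E → ℂ) : Prop :=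
  ∀ g ∈ lattice a₀ P, ∀ x, f (leftMul g x) = f x

theorem IsInvariant.exists_norm_le (hcov : TranslatesCover a₀ P) {f : E → ℂ}
    (hf : IsInvariant a₀ P f) (hc : Continuous f) : ∃ C, ∀ x, ‖f x‖ ≤ C := by
  have hmap : Continuous (latticeMap a₀ P) := by
    refine continuous_pi fun j => ?_
    fin_cases j <;> simp only [latticeMap] <;> fun_prop
  obtain ⟨C, hC⟩ := ((isCompact_Icc (a := 0) (b := 1)).image hmap).exists_bound_of_continuousOn
    hc.continuousOn
  refine ⟨C, fun x => ?_⟩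
  obtain ⟨g, hg, d, ⟨s, hs, rfl⟩, rfl⟩ := hcov x
  rw [hf g hg]
  exact hC _ ⟨s, ⟨fun i => (hs i).1, fun i => (hs i).2.le⟩, rfl⟩

theorem countable_lattice : (lattice a₀ P).Countable :=
  (Set.countable_range fun m : Fin 6 → ℤ => latticeMap a₀ P fun i => (m i : ℝ)).mono <| by
    rintro _ ⟨m, rfl⟩
    exact Set.mem_range_self m

theorem IsInvariant.eq_zero_of_ae (hcov : TranslatesCover a₀ P) {f : E → ℂ}
    (hf : IsInvariant a₀ P f) (hc : Continuous f)
    (h : ∀ᵐ x ∂(MeasureTheory.volume : MeasureTheory.Measure E), x ∈ fundDomain a₀ P → f x = 0) :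
    f = 0 := by
  have hsub : {x | ¬ f x = 0} ⊆
      ⋃ g ∈ lattice a₀ P, leftMul g '' {x | ¬ (x ∈ fundDomain a₀ P → f x = 0)} := by
    intro x hx
    obtain ⟨g, hg, d, hd, rfl⟩ := hcov x
    refine Set.mem_biUnion hg ⟨d, fun h => hx ?_, rfl⟩
    rw [hf g hg, h hd]
  have hae : f =ᵐ[(MeasureTheory.volume : MeasureTheory.Measure E)] 0 := by
    refine MeasureTheory.measure_mono_null hsub ?_
    refine (MeasureTheory.measure_biUnion_null_iff countable_lattice).2 fun g _ => ?_
    exact MeasureTheory.addHaar_image_eq_zero_of_differentiableOn_of_addHaar_eq_zero _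
      (fun x _ => (hasFDerivAt_leftMul g x).differentiableAt.differentiableWithinAt) h
  exact (hc.ae_eq_iff_eq _ continuous_const).1 hae

theorem IsInvariant.fderiv_frameMap {f : E → ℂ} (hf : IsInvariant a₀ P f)
    (hd : Differentiable ℝ f) (u : E) :
    IsInvariant a₀ P fun x => fderiv ℝ f x (frameMap x u) := by
  intro g hg x
  have hcomp : f ∘ leftMul g = f := funext (hf g hg)
  have hderiv := fderiv_comp x (hd _) (hasFDerivAt_leftMul g x).differentiableAt
  rw [hcomp, (hasFDerivAt_leftMul g x).fderiv] at hderiv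
  simp only [hderiv, frameMap_leftMul, ContinuousLinearMap.comp_apply]

variable {p : ℕ} {ψ : Form (p + 0)}

theorem isInvariant_coeff (hψ : ψ ∈ A a₀ P p 0) (w : Fin (p + 0) → E) :
    IsInvariant a₀ P (coeff ψ w) := by
  intro g hg x
  rw [coeff, coeff, ← hψ.2.1 g hg x, (hasFDerivAt_leftMul g x).fderiv]
  simp only [frameMap_leftMul]
  rfl

theorem differentiable_of_mem (hψ : ψ ∈ A a₀ P p 0) : Differentiable ℝ ψ :=
  hψ.1.differentiable (by simp)

theorem isSlotwiseComplexLinear_of_mem (hψ : ψ ∈ A a₀ P p 0) (x : E) :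
    IsSlotwiseComplexLinear (J x) (ψ x) :=
  (typeProj_self_eq_iff (k := p) (J_J x) (ψ x)).1 (hψ.2.2 x)

theorem isInvariant_dbarCoeff (hψ : ψ ∈ A a₀ P p 0) (u : E) (w : Fin (p + 0) → E) :
    IsInvariant a₀ P (dbarCoeff ψ u w) := by
  intro g hg x
  have hderiv (u w) := (isInvariant_coeff hψ w).fderiv_frameMap
    (differentiable_coeff (differentiable_of_mem hψ) w) u g hg x
  simp only at hderiv
  simp only [dbarCoeff, dbarDeriv, hderiv, fun w => isInvariant_coeff hψ w g hg x]

theorem continuous_dbarCoeff (hψ : ContDiff ℝ ∞ ψ) (u : E) (w : Fin (p + 0) → E) :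
    Continuous (dbarCoeff ψ u w) := by
  have hd : Differentiable ℝ ψ := hψ.differentiable (by simp)
  have hcoeff (w) := (differentiable_coeff hd w).continuous
  have hframe (w : E) := (contDiff_frameMap_apply w).continuous
  have hderiv (u : E) : Continuous fun x => fderiv ℝ (coeff ψ w) x (frameMap x u) := by
    simp only [fderiv_coeff hd]
    exact (((hψ.continuous_fderiv (by simp)).clm_apply (hframe u)).eval
      (continuous_pi fun j => hframe (w j))).add (continuous_finsetSum _ fun _ _ => hcoeff _)
  exact ((hderiv u).add (continuous_const.mul (hderiv _))).sub
    (continuous_finsetSum _ fun _ _ => hcoeff _)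

theorem eq_zero_of_apply_frame_eq_zero {k : ℕ} {x : E} {α : E [⋀^Fin k]→L[ℝ] ℂ}
    (h : ∀ I : Fin k → Fin 6, α (fun j => frame x (I j)) = 0) : α = 0 := by
  have hcomp : (α.compContinuousLinearMap (frameMap x)).toAlternatingMap.toMultilinearMap = 0 := by
    refine Module.Basis.ext_multilinear (fun _ => Pi.basisFun ℝ (Fin 6)) fun I => ?_
    change α (fun j => frameMap x (Pi.basisFun ℝ (Fin 6) (I j))) = 0
    simp only [Pi.basisFun_apply, frameMap_single, h]
  ext v
  choose w hw using fun j => frameMap_surjective x (v j)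
  rw [← funext hw]
  exact congrArg (fun f => f w) hcomp

theorem formInner_self {k : ℕ} (x : E) (α : E [⋀^Fin k]→L[ℝ] ℂ) :
    formInner x α α = ((1 / (k.factorial : ℝ) * ∑ I : Fin k → Fin 6,
      ‖α (fun j => frame x (I j))‖ ^ 2 : ℝ) : ℂ) := by
  rw [formInner]
  push_cast
  congr 1
  exact Finset.sum_congr rfl fun I _ => Complex.mul_conj' _

theorem formInner_self_eq_zero {k : ℕ} {x : E} {α : E [⋀^Fin k]→L[ℝ] ℂ} :
    formInner x α α = 0 ↔ α = 0 := by
  refine ⟨fun h => eq_zero_of_apply_frame_eq_zero (x := x) fun I => ?_, ?_⟩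
  · rw [formInner_self, Complex.ofReal_eq_zero] at h
    have hsum := (mul_eq_zero.1 h).resolve_left (by positivity)
    rw [Finset.sum_eq_zero_iff_of_nonneg fun _ _ => by positivity] at hsum
    simpa using hsum I (Finset.mem_univ I)
  · rintro rfl
    simp [formInner]

theorem ae_eq_zero_of_L2_self_eq_zero {k : ℕ} {α : Form k} (hα : ContCoeff α)
    (h : L2 a₀ P α α = 0) :
    ∀ᵐ x ∂(MeasureTheory.volume : MeasureTheory.Measure E), x ∈ fundDomain a₀ P → α x = 0 := by
  set F : E → ℝ := fun x => 1 / (k.factorial : ℝ) * ∑ I : Fin k → Fin 6,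
    ‖α x (fun j => frame x (I j))‖ ^ 2
  have hformInner (x) : formInner x (α x) (α x) = F x := formInner_self x (α x)
  have hint := (integrable_inner a₀ P hα hα).re
  rw [L2] at h
  simp only [hformInner, integral_complex_ofReal, Complex.ofReal_eq_zero] at h
  simp only [hformInner] at hint
  have hmeas : MeasurableSet {x | F x = 0} := measurableSet_eq_fun
    (continuous_const.mul (continuous_finsetSum _ fun I _ => (hα I).norm.pow 2)).measurable
    measurable_const
  have hae := (MeasureTheory.integral_eq_zero_iff_of_nonneg
    (fun x => show 0 ≤ F x by positivity) hint).1 h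
  filter_upwards [(MeasureTheory.ae_restrict_iff hmeas).1 hae] with x hx hxD
  rw [← formInner_self_eq_zero (x := x), hformInner, hx hxD]
  exact Complex.ofReal_zero

theorem mem_harmonic_iff (hcov : TranslatesCover a₀ P) :
    ψ ∈ harmonic a₀ P p 0 ↔ ψ ∈ A a₀ P p 0 ∧ ∀ u w x, dbarCoeff ψ u w x = 0 := by
  have hdbar (hψ : ψ ∈ A a₀ P p 0) (x) :=
    dbar_eq_zero_iff (differentiable_of_mem hψ) (isSlotwiseComplexLinear_of_mem hψ) x
  constructor
  · rintro ⟨hψ, -, h⟩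
    have hL2 : L2 a₀ P (dbar p 0 ψ) (dbar p 0 ψ) = 0 := by
      rw [h ψ hψ]
      simp [L2, formInner]
    refine ⟨hψ, fun u w => congrFun ?_⟩
    refine (isInvariant_dbarCoeff hψ u w).eq_zero_of_ae hcov (continuous_dbarCoeff hψ.1 u w) ?_
    filter_upwards [ae_eq_zero_of_L2_self_eq_zero (contCoeff_dbar hψ.1) hL2] with x hx hxD
    exact (hdbar hψ x).1 (hx hxD) u w
  · rintro ⟨hψ, h⟩
    have hzero : dbar p 0 ψ = 0 := funext fun x => (hdbar hψ x).2 fun u w => h u w x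
    refine ⟨hψ, ?_⟩
    rw [IsLaplacian, hzero]
    exact IsDbarStar.zero

end Harmonic

section Liouville

theorem eq_zero_of_bounded_addConstMap {V F : Type*} [AddCommMonoid V] [NormedAddCommGroup F]
    [NormedSpace ℝ F] {a : V} {b : F} (f : AddConstMap V F a b) {C : ℝ} (hC : ∀ x, ‖f x‖ ≤ C) :
    b = 0 := by
  by_contra hb
  obtain ⟨n, hn⟩ := exists_nat_gt ((C + C) / ‖b‖)
  rw [div_lt_iff₀ (norm_pos_iff.2 hb)] at hn
  have hnsmul : ‖f (0 + n • a) - f 0‖ = n * ‖b‖ := by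
    rw [AddConstMapClass.map_add_nsmul, add_sub_cancel_left, ← Nat.cast_smul_eq_nsmul ℝ, norm_smul,
      Real.norm_natCast]
  exact absurd hn (not_lt.2 (hnsmul ▸ (norm_sub_le _ _).trans (add_le_add (hC _) (hC _))))

theorem differentiable_complex_of_fderiv_one_add_I_smul {F : Type*} [NormedAddCommGroup F]
    [NormedSpace ℂ F] {h : ℂ → F} (hd : Differentiable ℝ h)
    (hzero : ∀ z, fderiv ℝ h z 1 + Complex.I • fderiv ℝ h z Complex.I = 0) :
    Differentiable ℂ h := by
  refine fun z => differentiableAt_complex_iff_differentiableAt_real.2 ⟨hd z, ?_⟩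
  rw [eq_neg_of_add_eq_zero_left (hzero z), smul_neg, smul_smul, Complex.I_mul_I, neg_one_smul,
    neg_neg]

/-- The increments of `h` are entire and bounded, hence constant, so `h` grows linearly. -/
theorem apply_eq_apply_of_bounded_of_dbar_eq_const {F : Type*} [NormedAddCommGroup F]
    [NormedSpace ℂ F] {h : ℂ → F} (hd : Differentiable ℝ h) {C : ℝ} (hC : ∀ z, ‖h z‖ ≤ C) {c : F}
    (hc : ∀ z, fderiv ℝ h z 1 + Complex.I • fderiv ℝ h z Complex.I = c) (z w : ℂ) :
    h z = h w := by
  set d := z - w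
  have hincr (y) : HasFDerivAt (fun y => h (y + d) - h y)
      (fderiv ℝ h (y + d) - fderiv ℝ h y) y :=
    ((hd (y + d)).hasFDerivAt.comp y ((hasFDerivAt_id y).add_const d)).sub (hd y).hasFDerivAt
  have hentire : Differentiable ℂ fun y => h (y + d) - h y := by
    refine differentiable_complex_of_fderiv_one_add_I_smul
      (fun y => (hincr y).differentiableAt) fun y => ?_
    rw [(hincr y).fderiv, sub_apply, sub_apply, smul_sub, ← add_sub_add_comm, hc, hc, sub_self]
  have hbdd : Bornology.IsBounded (Set.range fun y => h (y + d) - h y) := by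
    refine isBounded_iff_forall_norm_le.2 ⟨C + C, ?_⟩
    rintro _ ⟨y, rfl⟩
    exact (norm_sub_le _ _).trans (add_le_add (hC _) (hC _))
  have hconst (y) : h (y + d) = h y + (h (w + d) - h w) :=
    eq_add_of_sub_eq' (hentire.apply_eq_apply_of_bounded hbdd y w)
  have hzero := eq_zero_of_bounded_addConstMap ⟨h, hconst⟩ hC
  rwa [sub_eq_zero, add_sub_cancel] at hzero

/-- The fields `e₁, e₃, e₅`, which form a frame over `ℂ`. -/
def hol : Fin 3 → E := ![Pi.single 0 1, Pi.single 2 1, Pi.single 4 1]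

theorem J_zero_hol (j : Fin 3) :
    J 0 (hol j) = ![Pi.single 1 1, Pi.single 3 1, Pi.single 5 1] j := by
  funext i
  fin_cases j <;> fin_cases i <;> simp [J_zero_apply, hol]

theorem exists_hol_or_J_zero_hol_eq_single (i : Fin 6) :
    ∃ j, hol j = Pi.single i 1 ∨ J 0 (hol j) = Pi.single i 1 := by
  simp only [J_zero_hol]
  refine ⟨![0, 0, 1, 1, 2, 2] i, ?_⟩
  fin_cases i <;> simp [hol]

/-- The complex plane through `x` spanned by the frame vectors `hol j` and `J (hol j)`. -/
def holPlane (j : Fin 3) (x : E) : ℂ →L[ℝ] E :=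
  Complex.reCLM.smulRight (frameMap x (hol j)) + Complex.imCLM.smulRight (frameMap x (J 0 (hol j)))

theorem holPlane_one (j : Fin 3) (x : E) : holPlane j x 1 = frameMap x (hol j) := by
  simp [holPlane]

theorem holPlane_I (j : Fin 3) (x : E) : holPlane j x Complex.I = frameMap x (J 0 (hol j)) := by
  simp [holPlane]

theorem holPlane_add_holPlane (j : Fin 3) (x : E) (z : ℂ) :
    holPlane j (x + holPlane j x z) = holPlane j x := by
  have hplane : frameMap (x + holPlane j x z) (hol j) = frameMap x (hol j) ∧
      frameMap (x + holPlane j x z) (J 0 (hol j)) = frameMap x (J 0 (hol j)) := by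
    constructor <;> fin_cases j <;>
      simp [holPlane, frameMap_apply, J_zero_apply, hol, Matrix.vecHead, Matrix.vecTail]
  rw [holPlane, hplane.1, hplane.2, ← holPlane]

theorem dbarDeriv_hol (f : E → ℂ) (j : Fin 3) (x : E) :
    dbarDeriv f (hol j) x =
      fderiv ℝ f x (holPlane j x 1) + Complex.I * fderiv ℝ f x (holPlane j x Complex.I) := by
  rw [dbarDeriv, holPlane_one, holPlane_I]

variable {a₀ : ℝ} {P : Matrix (Fin 2) (Fin 2) ℝ} {f : E → ℂ}

theorem IsInvariant.fderiv_comp_holPlane_eq_zero (hcov : TranslatesCover a₀ P)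
    (hf : IsInvariant a₀ P f) (hd : Differentiable ℝ f) {j : Fin 3} {c : ℂ}
    (hc : ∀ x, dbarDeriv f (hol j) x = c) (x : E) : fderiv ℝ f x ∘L holPlane j x = 0 := by
  obtain ⟨C, hC⟩ := hf.exists_norm_le hcov hd.continuous
  have hderiv (z) : HasFDerivAt (fun z => f (x + holPlane j x z))
      (fderiv ℝ f (x + holPlane j x z) ∘L holPlane j x) z :=
    (hd _).hasFDerivAt.comp z ((holPlane j x).hasFDerivAt.const_add x)
  have hdbar (z) : fderiv ℝ (fun z => f (x + holPlane j x z)) z 1 +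
      Complex.I • fderiv ℝ (fun z => f (x + holPlane j x z)) z Complex.I = c := by
    rw [(hderiv z).fderiv, ← hc (x + holPlane j x z), dbarDeriv_hol, holPlane_add_holPlane]
    rfl
  have hconst : (fun z => f (x + holPlane j x z)) = fun _ => f (x + holPlane j x 0) :=
    funext fun z => apply_eq_apply_of_bounded_of_dbar_eq_const
      (fun z => (hderiv z).differentiableAt) (fun z => hC _) hdbar z 0
  have hzero := hderiv 0
  rw [hconst, map_zero, add_zero] at hzero
  exact hzero.unique (hasFDerivAt_const _ _)

theorem IsInvariant.eq_zero_of_dbarDeriv_eq_const (hcov : TranslatesCover a₀ P)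
    (hf : IsInvariant a₀ P f) (hd : Differentiable ℝ f) {j : Fin 3} {c : ℂ}
    (hc : ∀ x, dbarDeriv f (hol j) x = c) : c = 0 := by
  have hzero (z) := congrArg (fun L => L z) (hf.fderiv_comp_holPlane_eq_zero hcov hd hc 0)
  simp only [ContinuousLinearMap.comp_apply, zero_apply] at hzero
  rw [← hc 0, dbarDeriv_hol, hzero, hzero, mul_zero, add_zero]

theorem IsInvariant.apply_eq_apply_of_dbarDeriv_eq_const (hcov : TranslatesCover a₀ P)
    (hf : IsInvariant a₀ P f) (hd : Differentiable ℝ f)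
    (hc : ∀ j, ∃ c, ∀ x, dbarDeriv f (hol j) x = c) (x y : E) : f x = f y := by
  refine is_const_of_fderiv_eq_zero hd (fun x => ?_) x y
  have hplane (j z) : fderiv ℝ f x (holPlane j x z) = 0 := by
    obtain ⟨c, hc⟩ := hc j
    exact congrArg (fun L => L z) (hf.fderiv_comp_holPlane_eq_zero hcov hd hc x)
  have hbasis : (fderiv ℝ f x ∘L frameMap x).toLinearMap = 0 := by
    refine (Pi.basisFun ℝ (Fin 6)).ext fun i => ?_
    rw [Pi.basisFun_apply]
    obtain ⟨j, hj | hj⟩ := exists_hol_or_J_zero_hol_eq_single i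
    · simpa [← hj, holPlane_one] using hplane j 1
    · simpa [← hj, holPlane_I] using hplane j Complex.I
  ext v
  obtain ⟨w, rfl⟩ := frameMap_surjective x v
  exact congrArg (fun L => L w) hbasis

end Liouville

section StructureConstants

/-- The structure constants of `∂̄` on `(1,0)`-vectors in the frame `hol`:
`dbarTangent (hol j) (hol k)` is `∑ l, dbarConst j k l • hol l`, where `I` acts as `J`. -/
def dbarConst : Fin 3 → Matrix (Fin 3) (Fin 3) ℂ :=
  ![!![0, 0, 0; 0, 0, 0; 0, Complex.I, 0], !![0, -1, 0; 0, 0, 0; 0, 0, 0],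
    !![0, 0, -1; 0, 0, 0; 0, 0, 0]]

theorem dbarTangent_hol (j k : Fin 3) : dbarTangent (hol j) (hol k) =
    ∑ l, ((dbarConst j k l).re • hol l + (dbarConst j k l).im • J 0 (hol l)) := by
  funext i
  fin_cases j <;> fin_cases k <;> fin_cases i <;>
    simp [dbarTangent, bracket, conn, J_zero_apply, hol, dbarConst, Fin.sum_univ_succ,
      Matrix.vecHead, Matrix.vecTail] <;> norm_num

/-- A grading of the frame `hol` for which the matrices `dbarConst j` are strictly triangular. -/
def weight : Fin 3 → ℕ := ![2, 0, 1]

theorem weight_lt_weight {j k l : Fin 3} (h : dbarConst j k l ≠ 0) : weight l < weight k := by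
  fin_cases j <;> fin_cases k <;> fin_cases l <;> simp [dbarConst, weight] at h ⊢

theorem dbarConst_self (j k : Fin 3) : dbarConst j k k = 0 :=
  by_contra fun h => lt_irrefl _ (weight_lt_weight h)

theorem eq_and_eq_of_dbarConst_ne_zero {j k l k' l' : Fin 3} (h : dbarConst j k l ≠ 0)
    (h' : dbarConst j k' l' ≠ 0) : k = k' ∧ l = l' := by
  fin_cases j <;> fin_cases k <;> fin_cases l <;> simp [dbarConst] at h <;>
    fin_cases k' <;> fin_cases l' <;> simp [dbarConst] at h' ⊢

variable {p : ℕ}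

theorem coeff_update_dbarTangent_hol {ψ : Form p} (hJ : ∀ x, IsSlotwiseComplexLinear (J x) (ψ x))
    (j : Fin 3) (K : Fin p → Fin 3) (m : Fin p) (x : E) :
    coeff ψ (Function.update (hol ∘ K) m (dbarTangent (hol j) (hol (K m)))) x =
      ∑ l, dbarConst j (K m) l * coeff ψ (hol ∘ Function.update K m l) x := by
  let L := ((ψ x).toContinuousMultilinearMap.toContinuousLinearMap
    (fun i => frameMap x (hol (K i))) m).comp (frameMap x)
  have hL (z) : coeff ψ (Function.update (hol ∘ K) m z) x = L z := coeff_update ψ (hol ∘ K) m z x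
  rw [dbarTangent_hol, hL, map_sum]
  refine Finset.sum_congr rfl fun l _ => ?_
  rw [map_add, map_smul, map_smul, ← hL, ← hL, coeff_update_J hJ, Function.comp_update,
    Complex.real_smul, Complex.real_smul, mul_comm Complex.I, ← mul_assoc, mul_right_comm,
    ← add_mul, Complex.re_add_im]

end StructureConstants

section Constancy

variable {p : ℕ} {a₀ : ℝ} {P : Matrix (Fin 2) (Fin 2) ℝ} {ψ : Form (p + 0)}

theorem dbarDeriv_coeff_hol (hcov : TranslatesCover a₀ P) (hψ : ψ ∈ harmonic a₀ P p 0) (j : Fin 3)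
    (K : Fin (p + 0) → Fin 3) (x : E) :
    dbarDeriv (coeff ψ (hol ∘ K)) (hol j) x =
      ∑ m, ∑ l, dbarConst j (K m) l * coeff ψ (hol ∘ Function.update K m l) x := by
  have hJ := isSlotwiseComplexLinear_of_mem hψ.1
  have hclosed := ((mem_harmonic_iff hcov).1 hψ).2 (hol j) (hol ∘ K) x
  simp only [← coeff_update_dbarTangent_hol hJ]
  exact sub_eq_zero.1 hclosed

/-- By induction on the weight of `K`: the `∂̄`-derivatives only involve coefficients of smaller
weight, so they are constant. -/
theorem coeff_hol_eq_coeff_hol (hcov : TranslatesCover a₀ P) (hψ : ψ ∈ harmonic a₀ P p 0)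
    (K : Fin (p + 0) → Fin 3) (x y : E) : coeff ψ (hol ∘ K) x = coeff ψ (hol ∘ K) y := by
  induction hn : ∑ m, weight (K m) using Nat.strong_induction_on generalizing K x y with
  | _ n ih =>
  refine (isInvariant_coeff hψ.1 _).apply_eq_apply_of_dbarDeriv_eq_const hcov
    (differentiable_coeff (differentiable_of_mem hψ.1) _)
    (fun j => ⟨∑ m, ∑ l, dbarConst j (K m) l * coeff ψ (hol ∘ Function.update K m l) 0,
      fun x => (dbarDeriv_coeff_hol hcov hψ j K x).trans ?_⟩) x y
  refine Finset.sum_congr rfl fun m _ => Finset.sum_congr rfl fun l _ => ?_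
  by_cases hl : dbarConst j (K m) l = 0
  · rw [hl, zero_mul, zero_mul]
  have hweight : ∑ i, weight (Function.update K m l i) < n := by
    rw [← hn]
    refine Finset.sum_lt_sum (fun i _ => ?_)
      ⟨m, Finset.mem_univ m, by rw [Function.update_self]; exact weight_lt_weight hl⟩
    obtain rfl | hi := eq_or_ne i m
    · rw [Function.update_self]
      exact (weight_lt_weight hl).le
    · rw [Function.update_of_ne hi]
  rw [ih _ hweight _ x 0 rfl]

theorem sum_dbarConst_mul_coeff_hol (hcov : TranslatesCover a₀ P) (hψ : ψ ∈ harmonic a₀ P p 0)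
    (j : Fin 3) (K : Fin (p + 0) → Fin 3) (x : E) :
    ∑ m, ∑ l, dbarConst j (K m) l * coeff ψ (hol ∘ Function.update K m l) x = 0 := by
  refine (isInvariant_coeff hψ.1 (hol ∘ K)).eq_zero_of_dbarDeriv_eq_const hcov
    (differentiable_coeff (differentiable_of_mem hψ.1) _) (j := j) fun y => ?_
  rw [dbarDeriv_coeff_hol hcov hψ]
  simp only [coeff_hol_eq_coeff_hol hcov hψ _ y x]

end Constancy

section CoefficientVanishing

theorem IsSlotwiseComplexLinear.eq_zero_of_forall_comp_eq_zero {ι κ V : Type*} [DecidableEq ι]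
    [Finite ι] {A : V → V} {h : (ι → V) → ℂ} (hh : IsSlotwiseComplexLinear A h) {e : κ → V}
    (he : ∀ K : ι → κ, h (e ∘ K) = 0) {v : ι → V} (hv : ∀ i, ∃ k, e k = v i ∨ A (e k) = v i) :
    h v = 0 := by
  cases nonempty_fintype ι
  choose K hK using hv
  have key (s : Finset ι) : h (s.piecewise v (e ∘ K)) = 0 := by
    induction s using Finset.induction_on with
    | empty => rw [Finset.piecewise_empty, he]
    | insert l s hl ih =>
      have hself : Function.update (s.piecewise v (e ∘ K)) l (e (K l)) = s.piecewise v (e ∘ K) :=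
        Function.update_eq_iff.2
          ⟨(Finset.piecewise_eq_of_notMem s v (e ∘ K) hl).symm, fun _ _ => rfl⟩
      rw [Finset.piecewise_insert]
      obtain hl | hl := hK l
      · rw [← hl, hself, ih]
      · rw [← hl, hh.map_update, hself, ih, mul_zero]
  simpa using key Finset.univ

theorem map_comp_eq_zero_of_forall_strictMono {R M N κ : Type*} [Semiring R] [AddCommMonoid M]
    [Module R M] [AddCommGroup N] [Module R N] [LinearOrder κ] {p : ℕ} (f : M [⋀^Fin p]→ₗ[R] N)
    {e : κ → M} (h : ∀ K : Fin p → κ, StrictMono K → f (e ∘ K) = 0) (K : Fin p → κ) :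
    f (e ∘ K) = 0 := by
  by_cases hK : Function.Injective K
  · have hsort := h (K ∘ Tuple.sort K)
      ((Tuple.monotone_sort K).strictMono_of_injective (hK.comp (Tuple.sort K).injective))
    rwa [← Function.comp_assoc, f.map_perm, smul_eq_zero_iff_eq] at hsort
  · exact f.map_eq_zero_of_not_injective _ fun he => hK he.of_comp

theorem eq_zero_of_coeff_hol_eq_zero {p : ℕ} {ψ : Form p}
    (hJ : ∀ x, IsSlotwiseComplexLinear (J x) (ψ x))
    (h : ∀ K : Fin p → Fin 3, StrictMono K → ∀ x, coeff ψ (hol ∘ K) x = 0) : ψ = 0 := by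
  funext x
  refine eq_zero_of_apply_frame_eq_zero (x := x) fun I => ?_
  simp only [← frameMap_single]
  exact (isSlotwiseComplexLinear_coeff (hJ x)).eq_zero_of_forall_comp_eq_zero
    (map_comp_eq_zero_of_forall_strictMono
      ((ψ x).compContinuousLinearMap (frameMap x)).toAlternatingMap fun K hK => h K hK x)
    fun i => exists_hol_or_J_zero_hol_eq_single (I i)

end CoefficientVanishing

section PhiWedge

variable {p : ℕ} {a₀ : ℝ} {P : Matrix (Fin 2) (Fin 2) ℝ}

theorem sum_det_updateRow_mul {n R : Type*} [Fintype n] [DecidableEq n] [CommRing R]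
    (M T : Matrix n n R) :
    ∑ m, (M.updateRow m ((M * T).row m)).det = T.trace * M.det := by
  have hcramer (m : n) : (M.updateRow m ((M * T).row m)).det = (M * T * M.adjugate) m m := by
    rw [← Matrix.cramer_transpose_apply, Matrix.cramer_eq_adjugate_mulVec,
      ← Matrix.adjugate_transpose, Matrix.mulVec_transpose]
    rfl
  calc
    ∑ m, (M.updateRow m ((M * T).row m)).det = (M * T * M.adjugate).trace :=
      Finset.sum_congr rfl fun m _ => hcramer m
    _ = T.trace * M.det := by
      rw [Matrix.trace_mul_comm, ← mul_assoc, Matrix.adjugate_mul, Matrix.smul_mul, one_mul,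
        Matrix.trace_smul, smul_eq_mul, mul_comm]

/-- The complex determinant of `p` vectors of `ℂᵖ`, as a continuous alternating map. -/
def detAlternating (p : ℕ) : (Fin p → ℂ) [⋀^Fin p]→L[ℂ] ℂ where
  __ := (Matrix.detRowAlternating : (Fin p → ℂ) [⋀^Fin p]→ₗ[ℂ] ℂ)
  cont := Continuous.matrix_det (A := fun M : Matrix (Fin p) (Fin p) ℂ => M) continuous_id

/-- The form `Φ^{I 0} ∧ ⋯ ∧ Φ^{I (p-1)}`, normalized as a determinant. -/
def PhiWedge (I : Fin p → Fin 3) : Form p := fun x =>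
  ((detAlternating p).restrictScalars ℝ).compContinuousLinearMap
    (ContinuousLinearMap.pi fun a => Phi x (I a))

theorem PhiWedge_apply (I : Fin p → Fin 3) (x : E) (v : Fin p → E) :
    PhiWedge I x v = (Matrix.of fun b a => Phi x (I a) (v b)).det := rfl

theorem Phi_frameMap (x w : E) (j : Fin 3) : Phi x j (frameMap x w) =
    ![(w 0 + w 1 * Complex.I : ℂ), w 2 + w 3 * Complex.I, w 4 + w 5 * Complex.I] j := by
  have hx : (Real.exp (x 0) : ℂ) ≠ 0 := by exact_mod_cast (Real.exp_pos _).ne'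
  fin_cases j <;>
    simp [Phi, coframe, dcoord, frameMap_apply, Real.exp_neg, -Complex.ofReal_exp] <;>
    field_simp
  ring

theorem coeff_PhiWedge (I : Fin p → Fin 3) (w : Fin p → E) (x : E) :
    coeff (PhiWedge I) w x = (Matrix.of fun b a => Phi 0 (I a) (frameMap 0 (w b))).det := by
  rw [coeff, PhiWedge_apply]
  simp only [Phi_frameMap]

theorem isSlotwiseComplexLinear_PhiWedge (I : Fin p → Fin 3) (x : E) :
    IsSlotwiseComplexLinear (J x) (PhiWedge I x) := by
  intro l
  ext v
  have hrow : (Matrix.of fun b a => Phi x (I a) (Function.update v l (J x (v l)) b)) =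
      (Matrix.of fun b a => Phi x (I a) (v b)).updateRow l
        (Complex.I • (Matrix.of fun b a => Phi x (I a) (v b)) l) := by
    ext b a
    obtain rfl | hb := eq_or_ne b l
    · simp [Phi_J]
    · simp [hb]
  rw [slotOp_apply, PhiWedge_apply, hrow, Matrix.det_updateRow_smul, Matrix.updateRow_eq_self]
  rfl

theorem contDiff_of_forall_contDiff_apply {k : ℕ} {ψ : Form k}
    (h : ∀ v, ContDiff ℝ ∞ fun x => ψ x v) : ContDiff ℝ ∞ ψ := by
  let ev : (E [⋀^Fin k]→L[ℝ] ℂ) →ₗ[ℝ] ((Fin k → Fin 6) → ℂ) :=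
    { toFun := fun α I => α fun j => frame 0 (I j)
      map_add' := fun _ _ => rfl
      map_smul' := fun _ _ => rfl }
  have hinj : LinearMap.ker ev = ⊥ := LinearMap.ker_eq_bot'.2 fun α hα =>
    eq_zero_of_apply_frame_eq_zero (x := 0) fun I => congrFun hα I
  obtain ⟨L, hL⟩ := ev.exists_leftInverse_of_injective hinj
  have hψ : ψ = fun x => L.toContinuousLinearMap (ev (ψ x)) :=
    funext fun x => (congrArg (fun l => l (ψ x)) hL).symm
  rw [hψ]
  exact L.toContinuousLinearMap.contDiff.comp (contDiff_pi.2 fun I => h _)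

theorem contDiff_Phi_apply (j : Fin 3) (v : E) : ContDiff ℝ ∞ fun x => Phi x j v := by
  have hcoframe (i) : ContDiff ℝ ∞ fun x => (coframe x i v : ℂ) := by
    refine Complex.ofRealCLM.contDiff.comp ?_
    fin_cases i <;>
      simp only [coframe, dcoord, Fin.zero_eta, Fin.mk_one, Fin.reduceFinMk, Matrix.cons_val,
        ContinuousLinearMap.coe_coe, ContinuousLinearMap.proj_apply, sub_apply, smul_apply] <;>
      fun_prop
  fin_cases j
  · exact (hcoframe 0).add (contDiff_const.mul (hcoframe 1))
  · exact (hcoframe 2).add (contDiff_const.mul (hcoframe 3))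
  · exact (hcoframe 4).add (contDiff_const.mul (hcoframe 5))

theorem contDiff_PhiWedge (I : Fin p → Fin 3) : ContDiff ℝ ∞ (PhiWedge I) := by
  refine contDiff_of_forall_contDiff_apply fun v => ?_
  simp only [PhiWedge_apply, Matrix.det_apply']
  exact ContDiff.sum fun σ _ => contDiff_const.mul
    (contDiff_prod fun i _ => contDiff_Phi_apply (I i) (v (σ i)))

theorem PhiWedge_mem (I : Fin p → Fin 3) : (PhiWedge I : Form (p + 0)) ∈ A a₀ P p 0 := by
  refine ⟨contDiff_PhiWedge I, fun g _ x => ?_, fun x =>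
    (typeProj_self_eq_iff (J_J x) _).2 (isSlotwiseComplexLinear_PhiWedge I x)⟩
  rw [(hasFDerivAt_leftMul g x).fderiv]
  ext v
  choose w hw using fun j => frameMap_surjective x (v j)
  rw [← funext hw]
  change PhiWedge I (leftMul g x) (fun j => frameMap g (frameMap x (w j))) = _
  simp only [← frameMap_leftMul]
  exact (coeff_PhiWedge I w _).trans (coeff_PhiWedge I w _).symm

theorem Phi_dbarTangent (u w : E) (k : Fin 3) :
    Phi 0 k (frameMap 0 (dbarTangent u w)) = ∑ l, Phi 0 l (frameMap 0 w) *
      (∑ j, conj (Phi 0 j (frameMap 0 u)) • dbarConst j) l k := by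
  simp only [Phi_frameMap]
  fin_cases k <;> apply Complex.ext <;>
    simp [dbarTangent, bracket, conn, J_zero_apply, dbarConst, Fin.sum_univ_succ] <;> ring

theorem dbarCoeff_PhiWedge (I : Fin p → Fin 3) (u : E) (w : Fin p → E) (x : E) :
    dbarCoeff (PhiWedge I) u w x =
      -∑ m, coeff (PhiWedge I) (Function.update w m (dbarTangent u (w m))) x := by
  have hconst : coeff (PhiWedge I) w = fun _ => coeff (PhiWedge I) w 0 :=
    funext fun y => by rw [coeff_PhiWedge, coeff_PhiWedge]
  have hderiv : dbarDeriv (coeff (PhiWedge I) w) u x = 0 := by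
    rw [hconst]
    simp [dbarDeriv]
  rw [dbarCoeff, hderiv, zero_sub]

theorem sum_coeff_PhiWedge_update_dbarTangent {I : Fin p → Fin 3} (hI : Function.Injective I)
    (hclosed : ∀ j l a, dbarConst j l (I a) ≠ 0 → l ∈ Set.range I) (u : E) (w : Fin p → E)
    (x : E) :
    ∑ m, coeff (PhiWedge I) (Function.update w m (dbarTangent u (w m))) x = 0 := by
  set D := ∑ j, conj (Phi 0 j (frameMap 0 u)) • dbarConst j with hD
  set M : Matrix (Fin p) (Fin p) ℂ := Matrix.of fun b a => Phi 0 (I a) (frameMap 0 (w b))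
  have hrow (m) : M.updateRow m ((M * D.submatrix I I).row m) = Matrix.of fun b a =>
      Phi 0 (I a) (frameMap 0 (Function.update w m (dbarTangent u (w m)) b)) := by
    ext b a
    obtain rfl | hb := eq_or_ne b m
    · simp only [Matrix.updateRow_self, Matrix.of_apply, Function.update_self,
        Phi_dbarTangent, ← hD]
      change ∑ a', M b a' * D (I a') (I a) = _
      refine Finset.sum_of_injOn I hI.injOn (by simp) (fun l _ hl => ?_) fun _ _ => rfl
      have hzero (j) : dbarConst j l (I a) = 0 :=
        by_contra fun h => hl (by simpa using hclosed j l a h)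
      simp [hD, Matrix.sum_apply, hzero]
    · simp [hb, M]
  have htrace : (D.submatrix I I).trace = 0 := by
    simp [Matrix.trace, hD, Matrix.sum_apply, dbarConst_self]
  simp only [coeff_PhiWedge, ← hrow, sum_det_updateRow_mul, htrace, zero_mul]

theorem PhiWedge_mem_harmonic (hcov : TranslatesCover a₀ P) {I : Fin p → Fin 3}
    (hI : Function.Injective I)
    (hclosed : ∀ j l a, dbarConst j l (I a) ≠ 0 → l ∈ Set.range I) :
    (PhiWedge I : Form (p + 0)) ∈ harmonic a₀ P p 0 := by
  refine (mem_harmonic_iff hcov).2 ⟨PhiWedge_mem I, fun u w x => ?_⟩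
  refine (dbarCoeff_PhiWedge (p := p) I u w x).trans ?_
  rw [sum_coeff_PhiWedge_update_dbarTangent hI hclosed, neg_zero]

theorem coeff_PhiWedge_hol_self {I : Fin p → Fin 3} (hI : Function.Injective I) (x : E) :
    coeff (PhiWedge I) (hol ∘ I) x = 1 := by
  have hdual (j k : Fin 3) : Phi 0 j (frameMap 0 (hol k)) = (1 : Matrix (Fin 3) (Fin 3) ℂ) k j := by
    rw [Phi_frameMap]
    fin_cases j <;> fin_cases k <;> simp [hol]
  simp only [coeff_PhiWedge, Function.comp_apply, hdual]
  exact (congrArg Matrix.det (Matrix.submatrix_one I hI)).trans Matrix.det_one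

end PhiWedge

section HodgeNumbers

variable {p : ℕ} {a₀ : ℝ} {P : Matrix (Fin 2) (Fin 2) ℝ}

theorem hodgeNumber_eq_one (hcov : TranslatesCover a₀ P) {I : Fin p → Fin 3}
    (hI : Function.Injective I)
    (hclosed : ∀ j l a, dbarConst j l (I a) ≠ 0 → l ∈ Set.range I)
    (h : ∀ ψ : Form (p + 0), ψ ∈ harmonic a₀ P p 0 → ∀ K : Fin (p + 0) → Fin 3, StrictMono K →
      K ≠ I → ∀ x, coeff ψ (hol ∘ K) x = 0) :
    hodgeNumber a₀ P p 0 = 1 := by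
  have hΦ : (PhiWedge I : Form (p + 0)) ∈ harmonic a₀ P p 0 := PhiWedge_mem_harmonic hcov hI hclosed
  have hne : (⟨PhiWedge I, hΦ⟩ : harmonic a₀ P p 0) ≠ 0 := by
    intro hzero
    have hone := coeff_PhiWedge_hol_self hI 0
    rw [show PhiWedge I = 0 from congrArg Subtype.val hzero] at hone
    exact zero_ne_one hone
  refine (finrank_eq_one_iff_of_nonzero' (⟨PhiWedge I, hΦ⟩ : harmonic a₀ P p 0) hne).2 ?_
  rintro ⟨ψ, hψ⟩
  set c := coeff ψ (hol ∘ I) 0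
  refine ⟨c, Subtype.ext (sub_eq_zero.1 ?_)⟩
  have hsub := sub_mem (Submodule.smul_mem _ c hΦ) hψ
  refine eq_zero_of_coeff_hol_eq_zero (isSlotwiseComplexLinear_of_mem hsub.1) fun K hK x => ?_
  obtain rfl | hKI := eq_or_ne K I
  · refine (coeff_hol_eq_coeff_hol hcov hsub K x 0).trans ?_
    change c * coeff (PhiWedge K) (hol ∘ K) 0 - c = 0
    rw [coeff_PhiWedge_hol_self hI, mul_one, sub_self]
  · exact h _ hsub K hK hKI x

theorem coeff_hol_update_eq_zero (hcov : TranslatesCover a₀ P) {ψ : Form (p + 0)}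
    (hψ : ψ ∈ harmonic a₀ P p 0) {K : Fin (p + 0) → Fin 3} (hK : Function.Injective K) {j l : Fin 3}
    {m : Fin (p + 0)} (h : dbarConst j (K m) l ≠ 0) (x : E) :
    coeff ψ (hol ∘ Function.update K m l) x = 0 := by
  have hsum := sum_dbarConst_mul_coeff_hol hcov hψ j K x
  have hunique {m' l'} (h' : dbarConst j (K m') l' ≠ 0) : m' = m ∧ l' = l :=
    (eq_and_eq_of_dbarConst_ne_zero h' h).imp_left fun h => hK h
  rw [Fintype.sum_eq_single m, Fintype.sum_eq_single l] at hsum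
  · exact (mul_eq_zero.1 hsum).resolve_left h
  · exact fun l' hl' => mul_eq_zero_of_left (by_contra fun h' => hl' (hunique h').2) _
  · exact fun m' hm' => Finset.sum_eq_zero fun l' _ =>
      mul_eq_zero_of_left (by_contra fun h' => hm' (hunique h').1) _

theorem hodgeNumber_one_zero (hcov : TranslatesCover a₀ P) : hodgeNumber a₀ P 1 0 = 1 := by
  refine hodgeNumber_eq_one hcov (I := ![0]) (by decide) ?_ fun ψ hψ K hK hKI x => ?_
  · intro j l a h
    fin_cases j <;> fin_cases l <;> fin_cases a <;> simp [dbarConst] at h ⊢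
  have hcases : K = Function.update ![0] 0 1 ∨ K = Function.update ![0] 0 2 := by
    revert K
    decide
  obtain rfl | rfl := hcases
  · exact coeff_hol_update_eq_zero hcov hψ (j := 1) (by decide) (by simp [dbarConst]) x
  · exact coeff_hol_update_eq_zero hcov hψ (j := 2) (by decide) (by simp [dbarConst]) x

theorem hodgeNumber_two_zero (hcov : TranslatesCover a₀ P) : hodgeNumber a₀ P 2 0 = 1 := by
  refine hodgeNumber_eq_one hcov (I := ![0, 2]) (by decide) ?_ fun ψ hψ K hK hKI x => ?_
  · intro j l a h
    fin_cases j <;> fin_cases l <;> fin_cases a <;> simp [dbarConst] at h ⊢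
  have hcases : K = Function.update ![0, 2] 1 1 ∨ K = Function.update ![0, 2] 0 1 := by
    revert K
    decide
  obtain rfl | rfl := hcases
  · exact coeff_hol_update_eq_zero hcov hψ (j := 0) (by decide) (by simp [dbarConst]) x
  · exact coeff_hol_update_eq_zero hcov hψ (j := 1) (by decide) (by simp [dbarConst]) x

theorem hodgeNumber_three_zero (hcov : TranslatesCover a₀ P) : hodgeNumber a₀ P 3 0 = 1 := by
  refine hodgeNumber_eq_one hcov (I := id) Function.injective_id (by simp) fun ψ _ K hK hKI x => ?_
  exact absurd hK.eq_id hKI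

end HodgeNumbers

end Solvmanifold

end

theorem mainTheorem7 (B : Matrix.SpecialLinearGroup (Fin 2) ℤ) (a₀ : ℝ) (ha₀ : a₀ ≠ 0)
    (P : Matrix (Fin 2) (Fin 2) ℝ) (hP : IsUnit P.det)
    (hB : P * (B : Matrix (Fin 2) (Fin 2) ℤ).map (Int.cast : ℤ → ℝ) * P⁻¹ =
      Matrix.diagonal ![Real.exp a₀, Real.exp (-a₀)]) :
    Solvmanifold.hodgeNumber a₀ P 1 0 = 1 ∧
      Solvmanifold.hodgeNumber a₀ P 2 0 = 1 ∧
      Solvmanifold.hodgeNumber a₀ P 3 0 = 1 := by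
  have hcov := Solvmanifold.translatesCover ha₀ hP hB
  exact ⟨Solvmanifold.hodgeNumber_one_zero hcov, Solvmanifold.hodgeNumber_two_zero hcov,
    Solvmanifold.hodgeNumber_three_zero hcov⟩
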